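/- \textbf{Setting.} Consider a discrete-time branching random walk on $\mathbb Z$ started from one particle at $0$ (generation $0$). In each generation every particle first jumps, independently, with law $\{a_y\}_{y\in\mathbb Z}$, and then, at the place it has jumped to, is replaced by a random number of children with law $\{p_k\}_{k\ge 0}$, all jumps and offspring numbers being independent. The children of the particles of generation $n$ form generation $n+1$. Assume that the offspring law has mean $m\in(0,1)$ and a finite third moment, and that the jump law is not the point mass at $0$, has mean $0$ and finite variance, and satisfies $K(\theta):=\sum_{y}a_y\theta^y<\infty$ for all $\theta\ge 1$. Then the equation $K(s)=1/m$ has exactly one solution in $(1,\infty)$; call it $\rho$. Let $M_n$ be the rightmost position of all particles of generations $0,\dots,n$, let $M=\sup_{n\ge 0} M_n$, and put $$\ell(n)=\rho^{n}P(M\ge n),\qquad g(c,n)=\rho^{cn}P(M_n\ge cn),\qquad c\geq 0,\ n\in\mathbb N.$$ The jump law has finite right range $R$ (an integer $R>0$) if $a_R>0$ and $a_k=0$ for all $k>R$; it is then called nearly right-continuous if $a_i>0$ for all $i=1,\dots,R$. \textbf{Theorem.} There exist $0<\underline\delta\le\overline\delta<\infty$ such that: (a) For every $c\in(0,\underline\delta)$,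 $$0<\liminf_{n\to\infty}g(c,n)\le\limsup_{n\to\infty}g(c,n)\le 1.$$ (b) If moreover the jump law has a finite right range $R$ and is nearly right-continuous, then there is $\kappa\in(0,1]$ such that $\lim_{n\to\infty}\ell(n)=\kappa$ and, for every $c\in(0,\underline\delta)$, $$\lim_{n\to\infty}\rho^{\lceil cn\rceil}P(M_n\ge \lceil cn\rceil)=\kappa ;$$ in particular $g(c,n)\to\kappa$ as $n\to\infty$ through those $n$ for which $cn$ is an integer. (c) For every $c>\overline\delta$, $\lim_{n\to\infty}g(c,n)=0$. Moreover, if the jump law has a finite right range $R$, then $\overline\delta<R$. -/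

import Mathlib

open MeasureTheory ProbabilityTheory Filter Topology

namespace BRW

/-- Particles are labelled by Ulam-Harris words: `[]` is the initial particle, and `i :: v` is the
`i`-th child (counted from `0`) of the particle `v`. The generation of `v` is `v.length`. -/
abbrev Vertex : Type := List ℕ

variable {Ω : Type*}

/-- `InTree N ω v`: the particle `v` is born, when each particle `w` has `N w ω` children. -/
def InTree (N : Vertex → Ω → ℕ) (ω : Ω) : Vertex → Prop
  | [] => True
  | i :: v => InTree N ω v ∧ i < N v ω

/-- The position of a particle. The initial particle sits at the origin. A particle `v` first jumps
by `ξ v` and then reproduces, so that all its children are born at `position v + ξ v`. -/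
def position (ξ : Vertex → Ω → ℤ) (ω : Ω) : Vertex → ℤ
  | [] => 0
  | _ :: v => position ξ ω v + ξ v ω

/-- `M_n`, the rightmost position of the particles of the generations `0, …, n`. -/
noncomputable def maxUpTo (ξ : Vertex → Ω → ℤ) (N : Vertex → Ω → ℕ) (n : ℕ) (ω : Ω) : EReal :=
  ⨆ v ∈ {v : Vertex | InTree N ω v ∧ v.length ≤ n}, ((position ξ ω v : ℝ) : EReal)

/-- `M = sup_n M_n`, the rightmost position ever reached. -/
noncomputable def maxEver (ξ : Vertex → Ω → ℤ) (N : Vertex → Ω → ℕ) (ω : Ω) : EReal :=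
  ⨆ n : ℕ, maxUpTo ξ N n ω

/-- The branching random walk with jump distribution `a` and offspring distribution `p`: all jumps
have law `a`, all offspring numbers have law `p`, and all of them are independent. -/
structure IsBranchingRandomWalk [MeasurableSpace Ω] (μ : Measure Ω) (a : PMF ℤ) (p : PMF ℕ)
    (ξ : Vertex → Ω → ℤ) (N : Vertex → Ω → ℕ) : Prop where
  measurable_jump : ∀ v, Measurable (ξ v)
  measurable_offspring : ∀ v, Measurable (N v)
  law : ∀ v, μ.map (fun ω => (ξ v ω, N v ω)) = a.toMeasure.prod p.toMeasure
  indep : iIndepFun (fun v ω => (ξ v ω, N v ω)) μ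

/-- `P(M_n ≥ x)`. -/
noncomputable def probUpTo [MeasurableSpace Ω] (μ : Measure Ω) (ξ : Vertex → Ω → ℤ)
    (N : Vertex → Ω → ℕ) (n : ℕ) (x : ℝ) : ℝ :=
  μ.real {ω | (x : EReal) ≤ maxUpTo ξ N n ω}

/-- `P(M ≥ x)`. -/
noncomputable def probEver [MeasurableSpace Ω] (μ : Measure Ω) (ξ : Vertex → Ω → ℤ)
    (N : Vertex → Ω → ℕ) (x : ℝ) : ℝ :=
  μ.real {ω | (x : EReal) ≤ maxEver ξ N ω}

/-- The mean `m` of the offspring distribution. -/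
noncomputable def offspringMean (p : PMF ℕ) : ℝ := ∑' k : ℕ, (p k).toReal * (k : ℝ)

/-- The offspring law has mean in `(0, 1)` and a finite third moment (hence finite lower moments). -/
structure OffspringAssumption (p : PMF ℕ) : Prop where
  third_moment : Summable fun k : ℕ => (p k).toReal * (k : ℝ) ^ 3
  mean_pos : 0 < offspringMean p
  mean_lt_one : offspringMean p < 1

/-- `K(θ) = E(θ ^ W₁)`, the generating function of the jump distribution. -/
noncomputable def genFun (a : PMF ℤ) (θ : ℝ) : ℝ := ∑' y : ℤ, (a y).toReal * θ ^ y

/-- The jump law is not the point mass at `0`, has mean zero and finite variance, and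
`K(θ) < ∞` for all `θ ≥ 1`. -/
structure JumpAssumption (a : PMF ℤ) : Prop where
  nondegenerate : a ≠ PMF.pure 0
  mean_zero : HasSum (fun y : ℤ => (a y).toReal * (y : ℝ)) 0
  finite_variance : Summable fun y : ℤ => (a y).toReal * (y : ℝ) ^ 2
  genFun_finite : ∀ θ : ℝ, 1 ≤ θ → Summable fun y : ℤ => (a y).toReal * θ ^ y

/-- `ρ(γ)`, the solution `s ∈ (1, ∞)` of `K(s) = γ`. -/
noncomputable def rho (a : PMF ℤ) (γ : ℝ) : ℝ := sInf {s : ℝ | 1 < s ∧ genFun a s = γ}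

/-- The jump distribution has the finite right range `R`. -/
def HasRightRange (a : PMF ℤ) (R : ℕ) : Prop :=
  0 < R ∧ a (R : ℤ) ≠ 0 ∧ ∀ k : ℤ, (R : ℤ) < k → a k = 0

/-- The jump distribution, of right range `R`, charges all of `1, …, R`. -/
def NearlyRightContinuous (a : PMF ℤ) (R : ℕ) : Prop :=
  ∀ i : ℕ, 1 ≤ i → i ≤ R → a (i : ℤ) ≠ 0

/-- `g(c, n) = ρ ^ (c n) P(M_n ≥ c n)` with `ρ = ρ(1 / m)`. -/
noncomputable def g [MeasurableSpace Ω] (μ : Measure Ω) (a : PMF ℤ) (p : PMF ℕ)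
    (ξ : Vertex → Ω → ℤ) (N : Vertex → Ω → ℕ) (c : ℝ) (n : ℕ) : ℝ :=
  rho a (offspringMean p)⁻¹ ^ (c * n) * probUpTo μ ξ N n (c * n)

/-- `g(c, n)` with `c n` rounded up to an integer: `ρ ^ ⌈c n⌉ P(M_n ≥ ⌈c n⌉)`. -/
noncomputable def gCeil [MeasurableSpace Ω] (μ : Measure Ω) (a : PMF ℤ) (p : PMF ℕ)
    (ξ : Vertex → Ω → ℤ) (N : Vertex → Ω → ℕ) (c : ℝ) (n : ℕ) : ℝ :=
  rho a (offspringMean p)⁻¹ ^ ⌈c * n⌉ * probUpTo μ ξ N n ⌈c * n⌉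

/-- `ℓ(n) = ρ ^ n P(M ≥ n)` with `ρ = ρ(1 / m)`. -/
noncomputable def ell [MeasurableSpace Ω] (μ : Measure Ω) (a : PMF ℤ) (p : PMF ℕ)
    (ξ : Vertex → Ω → ℤ) (N : Vertex → Ω → ℕ) (n : ℕ) : ℝ :=
  rho a (offspringMean p)⁻¹ ^ n * probEver μ ξ N n

end BRW

/-!
The maximum of the branching random walk obeys a recursion. Cutting off the first generation,
`q_n(x) = P(M_n ≥ x)` satisfies, for an integer `x > 0`,
`q_{n+1}(x) = ∑_y a_y Φ(q_n(x - y))`, and `q_n(x) = 1` for `x ≤ 0`, where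
`Φ(q) = ∑_k p_k (1 - (1 - q) ^ k)`: the subtrees of the children of the initial particle are
independent copies of the whole process (`IsBranchingRandomWalk.measureReal_hitEvent`). Everything
else is analysis of this monotone recursion. The function `Φ` is nondecreasing, `m`-Lipschitz, and
`m q - C q² ≤ Φ(q) ≤ m q`, while `x ↦ s ^ (-x)` is an eigenfunction, with eigenvalue `K(s)`, of the
averaging operator of the jump law. As `K` is strictly increasing on `[1, ∞)`, `m K(s)` is smaller
than `1` for `1 ≤ s < ρ` and larger than `1` for `s > ρ`.

* For `m K(s) ≥ 1`, the function `(m K(s)) ^ n s ^ (-x)` is a supersolution. With `s = ρ` this gives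
  `q_n(x) ≤ ρ ^ (-x)`, and with `s > ρ` it shows that `g(c, n) → 0` for
  `c > log (m K(s)) / log (s / ρ)` (`hitProb_le_pow_mul_zpow`). This threshold is smaller than the
  right range `R`, because `K(s) s ^ (-R)` is strictly decreasing
  (`JumpAssumption.genFun_lt_of_hasRightRange`).
* For `1 < r < ρ < s < ρ²`, a small multiple of the positive part of
  `ρ ^ (-x) + A s ^ (-x) - s ^ (-2 x) - (1 + A) (m K(r)) ^ n r ^ (-x)` is a subsolution
  (`exists_le_hitProb`). Along `x = c n` with `c < log (1 / (m K(r))) / log (ρ / r)` its first term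
  dominates, so that `g(c, n)` stays away from `0`.
* In the same range of `c`, the Lipschitz bound yields
  `P(M ≥ x) - P(M_n ≥ x) ≤ (m K(r)) ^ n r ^ (-x) = o(ρ ^ (-x))` (`hitProbEver_sub_le`), so that
  the limits along `⌈c n⌉` reduce to the convergence of `u(x) = ρ ^ x P(M ≥ x)`.
* Up to an exponentially small error, `u` is harmonic on `x > 0` for the tilted walk with step law
  `m a_y ρ ^ y`, which has positive drift and steps at most `R`. Near-maximal values of `u`
  propagate to the left by steps of size `1`, as `a_1 > 0`, and a window of `R` near-maximal values
  propagates to the right, as the walk cannot jump over it (`minimum_principle`). Hence `u`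
  converges (`exists_tendsto_of_almost_harmonic`), and the previous lower bound makes its limit
  positive.
-/

namespace BRW

/-! ### The generating function of the jump law -/

lemma hasSum_pmf {ι : Type*} (a : PMF ι) : HasSum (fun y => (a y).toReal) 1 := by
  have h := a.tsum_coe
  have hs : Summable fun y => (a y).toReal := ENNReal.summable_toReal (by rw [h]; simp)
  have : ∑' y, (a y).toReal = 1 := by
    rw [← ENNReal.tsum_toReal_eq fun y => a.apply_ne_top y, h]; simp
  exact this ▸ hs.hasSum

lemma pow_sub_pow_ge {s t : ℝ} (hs : 1 ≤ s) (hst : s ≤ t) (n : ℕ) :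
    n * (t - s) ≤ t ^ n - s ^ n := by
  induction n with
  | zero => simp
  | succ n ih =>
    have h1 : 1 ≤ s ^ n := one_le_pow₀ hs
    have h2 : 0 ≤ t ^ n - s ^ n := sub_nonneg.2 (by gcongr)
    push_cast
    rw [pow_succ, pow_succ]
    nlinarith [mul_nonneg h2 (by linarith : 0 ≤ t - 1), mul_nonneg (by linarith : 0 ≤ s ^ n - 1)
      (by linarith : 0 ≤ t - s)]

lemma inv_pow_sub_inv_pow_lt {s t : ℝ} (hs : 1 ≤ s) (hst : s < t) (n : ℕ) :
    s⁻¹ ^ (n + 1) - t⁻¹ ^ (n + 1) < (n + 1) * (t - s) := by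
  have hs0 : 0 < s := by linarith
  have ht0 : 0 < t := by linarith
  have hs1 : s⁻¹ ≤ 1 := inv_le_one_of_one_le₀ hs
  have ht1 : t⁻¹ ≤ 1 := inv_le_one_of_one_le₀ (by linarith)
  have hi : t⁻¹ < s⁻¹ := inv_strictAnti₀ hs0 hst
  have hd : s⁻¹ - t⁻¹ < t - s := by
    have h : s⁻¹ - t⁻¹ = (t - s) * (s⁻¹ * t⁻¹) := by field_simp
    have h' : s⁻¹ * t⁻¹ < 1 := by
      have : t⁻¹ < 1 := inv_lt_one_of_one_lt₀ (by linarith)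
      have h0 : 0 < s⁻¹ := by positivity
      nlinarith
    rw [h]; nlinarith
  induction n with
  | zero => simpa using hd
  | succ n ih =>
    have h1 : t⁻¹ ^ (n + 1) ≤ 1 := pow_le_one₀ (by positivity) ht1
    have h0 : 0 ≤ t⁻¹ ^ (n + 1) := by positivity
    have h2 : 0 ≤ s⁻¹ ^ (n + 1) - t⁻¹ ^ (n + 1) := sub_nonneg.2 (by gcongr)
    have e : s⁻¹ ^ (n + 1 + 1) - t⁻¹ ^ (n + 1 + 1)
        = s⁻¹ * (s⁻¹ ^ (n + 1) - t⁻¹ ^ (n + 1)) + t⁻¹ ^ (n + 1) * (s⁻¹ - t⁻¹) := by ring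
    rw [e]
    push_cast
    nlinarith [mul_nonneg h2 (by linarith : 0 ≤ 1 - s⁻¹),
      mul_nonneg (by linarith : 0 ≤ 1 - t⁻¹ ^ (n + 1)) (by linarith : 0 ≤ s⁻¹ - t⁻¹)]

/-- On `[1, ∞)` the function `θ ↦ θ ^ y - y θ` is nondecreasing for every integer `y`. -/
lemma zpow_sub_zpow_ge {s t : ℝ} (hs : 1 ≤ s) (hst : s ≤ t) (y : ℤ) :
    s ^ y + y * (t - s) ≤ t ^ y := by
  rcases hst.eq_or_lt with rfl | hst'
  · simp
  rcases y with n | n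
  · have := pow_sub_pow_ge hs hst n
    simp only [Int.ofNat_eq_natCast, zpow_natCast, Int.cast_natCast]
    linarith
  · have := inv_pow_sub_inv_pow_lt hs hst' n
    simp only [zpow_negSucc, Int.cast_negSucc, ← inv_pow]
    push_cast
    linarith

lemma zpow_sub_zpow_gt {s t : ℝ} (hs : 1 ≤ s) (hst : s < t) {y : ℤ} (hy : y < 0) :
    s ^ y + y * (t - s) < t ^ y := by
  rcases y with n | n
  · simp only [Int.ofNat_eq_natCast] at hy
    omega
  · have := inv_pow_sub_inv_pow_lt hs hst n
    simp only [zpow_negSucc, Int.cast_negSucc, ← inv_pow]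
    push_cast
    linarith

variable {a : PMF ℤ} {p : PMF ℕ}

lemma toReal_pos_of_ne_zero {ι : Type*} {a : PMF ι} {y : ι} (h : a y ≠ 0) : 0 < (a y).toReal :=
  ENNReal.toReal_pos h (a.apply_ne_top y)

lemma JumpAssumption.exists_ne_zero (ha : JumpAssumption a) : ∃ y : ℤ, y ≠ 0 ∧ a y ≠ 0 := by
  by_contra! h
  apply ha.nondegenerate
  have h0 : a 0 = 1 := by
    have := a.tsum_coe
    rwa [tsum_eq_single 0 fun y hy => h y hy] at this
  ext y
  by_cases hy : y = 0
  · simp [hy, h0]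
  · simp [hy, h y hy]

lemma JumpAssumption.exists_neg (ha : JumpAssumption a) : ∃ y : ℤ, y < 0 ∧ a y ≠ 0 := by
  by_contra! h
  obtain ⟨y, hy, hay⟩ := ha.exists_ne_zero
  have hpos : 0 < y := lt_of_le_of_ne (not_lt.1 fun h' => hay (h y h')) hy.symm
  have hn : ∀ z : ℤ, 0 ≤ (a z).toReal * (z : ℝ) := fun z => by
    rcases lt_or_ge z 0 with hz | hz
    · simp [h z hz]
    · have : (0 : ℝ) ≤ z := by exact_mod_cast hz
      positivity
  have := (hasSum_zero_iff_of_nonneg hn).1 ha.mean_zero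
  have h1 := congrFun this y
  have h2 : (y : ℝ) ≠ 0 := by exact_mod_cast hy
  simp only [Pi.zero_apply, mul_eq_zero, h2, or_false] at h1
  exact (toReal_pos_of_ne_zero hay).ne' h1

lemma JumpAssumption.exists_pos (ha : JumpAssumption a) : ∃ y : ℤ, 0 < y ∧ a y ≠ 0 := by
  by_contra! h
  obtain ⟨y, hy, hay⟩ := ha.exists_neg
  have hn : ∀ z : ℤ, 0 ≤ -((a z).toReal * (z : ℝ)) := fun z => by
    rcases lt_or_ge 0 z with hz | hz
    · simp [h z hz]
    · have : (z : ℝ) ≤ 0 := by exact_mod_cast hz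
      have h0 : 0 ≤ (a z).toReal := ENNReal.toReal_nonneg
      nlinarith
  have := (hasSum_zero_iff_of_nonneg hn).1 (by simpa using ha.mean_zero.neg)
  have h1 := congrFun this y
  have h2 : (y : ℝ) ≠ 0 := by exact_mod_cast hy.ne
  simp only [Pi.zero_apply, neg_eq_zero, mul_eq_zero, h2, or_false] at h1
  exact (toReal_pos_of_ne_zero hay).ne' h1

lemma JumpAssumption.hasSum_genFun (ha : JumpAssumption a) {s : ℝ} (hs : 1 ≤ s) :
    HasSum (fun y : ℤ => (a y).toReal * s ^ y) (genFun a s) :=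
  (ha.genFun_finite s hs).hasSum

lemma genFun_one : genFun a 1 = 1 := by
  simpa [genFun] using (hasSum_pmf a).tsum_eq

/-- As the jumps are centred, `K(θ)` is the sum of the `a_y (θ ^ y - y θ)`, whose terms are
nondecreasing in `θ ≥ 1`, and strictly increasing for the `y < 0`. -/
lemma JumpAssumption.genFun_strictMono (ha : JumpAssumption a) {s t : ℝ} (hs : 1 ≤ s)
    (hst : s < t) : genFun a s < genFun a t := by
  obtain ⟨y, hy, hay⟩ := ha.exists_neg
  have h1 := (ha.hasSum_genFun hs).add (ha.mean_zero.mul_right (t - s))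
  rw [zero_mul, add_zero] at h1
  refine hasSum_lt (i := y) (fun z => ?_) ?_ h1 (ha.hasSum_genFun (hs.trans hst.le))
  · have := zpow_sub_zpow_ge hs hst.le z
    have h0 : 0 ≤ (a z).toReal := ENNReal.toReal_nonneg
    nlinarith
  · have := zpow_sub_zpow_gt hs hst hy
    have h0 := toReal_pos_of_ne_zero hay
    nlinarith

lemma zpow_le_one_add_zpow {s t : ℝ} (hs : 1 ≤ s) (hst : s ≤ t) (y : ℤ) : s ^ y ≤ 1 + t ^ y := by
  have ht : 0 < t := by linarith
  rcases le_or_gt 0 y with hy | hy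
  · have := zpow_le_zpow_left₀ hy (by linarith) hst
    linarith
  · have := zpow_le_one_of_nonpos₀ hs hy.le
    have : 0 < t ^ y := by positivity
    linarith

lemma JumpAssumption.genFun_continuousOn (ha : JumpAssumption a) (t : ℝ) :
    ContinuousOn (genFun a) (Set.Icc 1 t) := by
  rcases lt_or_ge t 1 with ht | ht
  · simp [Set.Icc_eq_empty (not_le.2 ht)]
  unfold genFun
  refine continuousOn_tsum (u := fun y : ℤ => (a y).toReal * (1 + t ^ y)) (fun y => ?_) ?_ ?_
  · refine continuousOn_const.mul (continuousOn_id.zpow₀ _ fun x hx => Or.inl ?_)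
    have := hx.1
    simp only [id_eq]
    linarith
  · simpa [mul_add] using (hasSum_pmf a).summable.add (ha.genFun_finite t ht)
  · intro y s hs
    have h0 : 0 ≤ (a y).toReal := ENNReal.toReal_nonneg
    have hs0 : 0 < s := by linarith [hs.1]
    rw [Real.norm_of_nonneg (by positivity)]
    exact mul_le_mul_of_nonneg_left (zpow_le_one_add_zpow hs.1 hs.2 y) h0

lemma JumpAssumption.existsUnique_genFun_eq (ha : JumpAssumption a) {γ : ℝ} (hγ : 1 < γ) :
    ∃! s : ℝ, 1 < s ∧ genFun a s = γ := by
  obtain ⟨y, hy, hay⟩ := ha.exists_pos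
  have hay0 := toReal_pos_of_ne_zero hay
  set t := 1 + γ / (a y).toReal
  have ht : 1 ≤ t := by simp only [t, le_add_iff_nonneg_right]; positivity
  have hKt : γ ≤ genFun a t := by
    have h1 : (a y).toReal * t ^ y ≤ genFun a t :=
      (ha.hasSum_genFun ht).summable.le_tsum y fun z _ => by positivity
    have h2 : t ≤ t ^ y := by
      simpa using zpow_le_zpow_right₀ ht (by omega : (1 : ℤ) ≤ y)
    have h3 : γ ≤ (a y).toReal * t := by
      simp only [t, mul_add, mul_one]
      rw [mul_div_cancel₀ _ hay0.ne']
      linarith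
    nlinarith
  obtain ⟨s, hs, hKs⟩ := intermediate_value_Icc ht (ha.genFun_continuousOn t)
    ⟨by rw [genFun_one]; exact hγ.le, hKt⟩
  have hs1 : 1 < s := lt_of_le_of_ne hs.1 fun h => by
    rw [← h, genFun_one] at hKs
    exact hγ.ne hKs
  refine ⟨s, ⟨hs1, hKs⟩, fun s' hs' => ?_⟩
  rcases lt_trichotomy s' s with h | h | h
  · have := ha.genFun_strictMono hs'.1.le h
    linarith [hs'.2]
  · exact h
  · have := ha.genFun_strictMono hs1.le h
    linarith [hs'.2]

lemma JumpAssumption.rho_spec (ha : JumpAssumption a) {γ : ℝ} (hγ : 1 < γ) :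
    1 < rho a γ ∧ genFun a (rho a γ) = γ := by
  obtain ⟨s, hs, hu⟩ := ha.existsUnique_genFun_eq hγ
  have : {s : ℝ | 1 < s ∧ genFun a s = γ} = {s} := by
    ext t
    exact ⟨fun h => hu t h, fun h => by rw [Set.mem_singleton_iff.1 h]; exact hs⟩
  rw [rho, this, csInf_singleton]
  exact hs

/-- `x ↦ s ^ (-x)` is an eigenfunction, with eigenvalue `K(s)`, of the averaging operator of the
jump law. -/
lemma JumpAssumption.hasSum_zpow_neg_sub (ha : JumpAssumption a) {s : ℝ} (hs : 1 ≤ s) (x : ℤ) :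
    HasSum (fun y : ℤ => (a y).toReal * s ^ (-(x - y))) (genFun a s * s ^ (-x)) := by
  have hs0 : s ≠ 0 := by positivity
  refine ((ha.hasSum_genFun hs).mul_right (s ^ (-x))).congr_fun fun y => ?_
  rw [mul_assoc, ← zpow_add₀ hs0]
  congr 2
  ring

/-- When the jumps are bounded by `R`, the function `s ↦ K(s) s ^ (-R)` is strictly decreasing. -/
lemma JumpAssumption.genFun_lt_of_hasRightRange (ha : JumpAssumption a) {R : ℕ}
    (hR : HasRightRange a R) {s t : ℝ} (hs : 1 ≤ s) (hst : s < t) :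
    genFun a t < genFun a s * (t / s) ^ R := by
  obtain ⟨y, hy, hay⟩ := ha.exists_neg
  have hs0 : 0 < s := by linarith
  have hq : 1 < t / s := (one_lt_div hs0).2 hst
  have e : ∀ z : ℤ, t ^ z = s ^ z * (t / s) ^ z := fun z => by
    rw [← mul_zpow, mul_div_cancel₀ _ hs0.ne']
  refine hasSum_lt (i := y) (fun z => ?_) ?_ (ha.hasSum_genFun (hs.trans hst.le))
    ((ha.hasSum_genFun hs).mul_right _)
  · rcases le_or_gt z R with hz | hz
    · simp only [e z, mul_assoc]
      gcongr
      simpa using zpow_le_zpow_right₀ hq.le hz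
    · simp [hR.2.2 z hz]
  · have h0 := toReal_pos_of_ne_zero hay
    simp only [e y, mul_assoc]
    gcongr
    simpa using zpow_lt_zpow_right₀ hq (by omega : y < (R : ℤ))

/-- Under a bounded jump law, tilting by `s > 1` makes the drift positive. -/
lemma JumpAssumption.exists_hasSum_tilted_drift (ha : JumpAssumption a) {R : ℕ}
    (hR : HasRightRange a R) {s : ℝ} (hs : 1 < s) :
    ∃ D, 0 < D ∧ HasSum (fun y : ℤ => (a y).toReal * s ^ y * (y : ℝ)) D := by
  have hs0 : 0 < s := by linarith
  have hb : ∀ y : ℤ, (y : ℝ) ≤ s ^ y * y := fun y => by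
    rcases le_or_gt 0 y with hy | hy
    · have h1 := one_le_zpow₀ hs.le hy
      have h2 : (0 : ℝ) ≤ y := by exact_mod_cast hy
      nlinarith
    · have h1 := zpow_le_one_of_nonpos₀ hs.le hy.le
      have h2 : (y : ℝ) ≤ 0 := by exact_mod_cast hy.le
      nlinarith
  have hsum : Summable fun y : ℤ => (a y).toReal * s ^ y * (y : ℝ) := by
    refine Summable.of_norm_bounded (ha.mean_zero.summable.abs.mul_left (s ^ R)) fun y => ?_
    rcases le_or_gt y R with hy | hy
    · have h1 : s ^ y ≤ s ^ R := by simpa using zpow_le_zpow_right₀ hs.le hy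
      have h0 : 0 < s ^ y := by positivity
      rw [Real.norm_eq_abs, abs_mul, abs_mul, abs_mul, abs_of_pos h0]
      have : 0 ≤ |(a y).toReal| * |(y : ℝ)| := by positivity
      nlinarith
    · simp [hR.2.2 y hy]
  obtain ⟨y, hy, hay⟩ := ha.exists_neg
  refine ⟨_, hasSum_lt (i := y) (fun z => ?_) ?_ ha.mean_zero hsum.hasSum, hsum.hasSum⟩
  · have h0 : 0 ≤ (a z).toReal := ENNReal.toReal_nonneg
    simp only [mul_assoc]
    exact mul_le_mul_of_nonneg_left (hb z) h0
  · have h0 := toReal_pos_of_ne_zero hay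
    simp only [mul_assoc]
    refine mul_lt_mul_of_pos_left ?_ h0
    have h1 : s ^ y < 1 := by simpa using zpow_lt_zpow_right₀ hs hy
    have h2 : (y : ℝ) < 0 := by exact_mod_cast hy
    nlinarith

/-! ### The offspring law -/

/-- The probability that at least one of the children of a particle is marked, when each child is
marked independently with probability `q`. -/
noncomputable def markedProb (p : PMF ℕ) (q : ℝ) : ℝ :=
  ∑' k : ℕ, (p k).toReal * (1 - (1 - q) ^ k)

section markedProb

variable {q r : ℝ}

lemma one_sub_pow_mem (hq : q ∈ Set.Icc (0 : ℝ) 1) (k : ℕ) :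
    1 - (1 - q) ^ k ∈ Set.Icc (0 : ℝ) 1 := by
  have h1 : 0 ≤ (1 - q) ^ k := pow_nonneg (by linarith [hq.2]) k
  have h2 : (1 - q) ^ k ≤ 1 := pow_le_one₀ (by linarith [hq.2]) (by linarith [hq.1])
  exact ⟨by linarith, by linarith⟩

lemma summable_markedProb (p : PMF ℕ) (hq : q ∈ Set.Icc (0 : ℝ) 1) :
    Summable fun k : ℕ => (p k).toReal * (1 - (1 - q) ^ k) := by
  refine Summable.of_nonneg_of_le (fun k => ?_) (fun k => ?_) (hasSum_pmf p).summable
  · exact mul_nonneg ENNReal.toReal_nonneg (one_sub_pow_mem hq k).1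
  · exact mul_le_of_le_one_right ENNReal.toReal_nonneg (one_sub_pow_mem hq k).2

lemma markedProb_mem (p : PMF ℕ) (hq : q ∈ Set.Icc (0 : ℝ) 1) :
    markedProb p q ∈ Set.Icc (0 : ℝ) 1 := by
  refine ⟨tsum_nonneg fun k => mul_nonneg ENNReal.toReal_nonneg (one_sub_pow_mem hq k).1, ?_⟩
  rw [← (hasSum_pmf p).tsum_eq]
  exact (summable_markedProb p hq).tsum_le_tsum
    (fun k => mul_le_of_le_one_right ENNReal.toReal_nonneg (one_sub_pow_mem hq k).2)
    (hasSum_pmf p).summable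

lemma markedProb_mono (p : PMF ℕ) (hq : q ∈ Set.Icc (0 : ℝ) 1) (hr : r ∈ Set.Icc (0 : ℝ) 1)
    (hqr : q ≤ r) : markedProb p q ≤ markedProb p r := by
  refine (summable_markedProb p hq).tsum_le_tsum (fun k => ?_) (summable_markedProb p hr)
  have : (1 - r) ^ k ≤ (1 - q) ^ k := pow_le_pow_left₀ (by linarith [hr.2]) (by linarith) k
  exact mul_le_mul_of_nonneg_left (by linarith) ENNReal.toReal_nonneg

lemma OffspringAssumption.summable_mean (hp : OffspringAssumption p) :
    Summable fun k : ℕ => (p k).toReal * (k : ℝ) := by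
  refine Summable.of_nonneg_of_le (fun k => by positivity) (fun k => ?_) hp.third_moment
  refine mul_le_mul_of_nonneg_left ?_ ENNReal.toReal_nonneg
  rcases Nat.eq_zero_or_pos k with rfl | hk
  · simp
  · have : (1 : ℝ) ≤ k := by exact_mod_cast hk
    exact le_self_pow₀ this (by norm_num)

lemma OffspringAssumption.summable_second (hp : OffspringAssumption p) :
    Summable fun k : ℕ => (p k).toReal * (k : ℝ) ^ 2 := by
  refine Summable.of_nonneg_of_le (fun k => by positivity) (fun k => ?_) hp.third_moment
  refine mul_le_mul_of_nonneg_left ?_ ENNReal.toReal_nonneg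
  rcases Nat.eq_zero_or_pos k with rfl | hk
  · simp
  · have : (1 : ℝ) ≤ k := by exact_mod_cast hk
    exact pow_le_pow_right₀ this (by norm_num)

lemma pow_sub_pow_le {u v : ℝ} (hu : 0 ≤ u) (huv : u ≤ v) (hv : v ≤ 1) (k : ℕ) :
    v ^ k - u ^ k ≤ k * (v - u) := by
  induction k with
  | zero => simp
  | succ k ih =>
    have h1 : u ^ k ≤ 1 := pow_le_one₀ hu (huv.trans hv)
    have h2 : 0 ≤ v ^ k - u ^ k := sub_nonneg.2 (by gcongr)
    push_cast
    rw [pow_succ, pow_succ]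
    nlinarith [mul_nonneg h2 (by linarith : 0 ≤ 1 - v), mul_nonneg (by linarith : 0 ≤ 1 - u ^ k)
      (by linarith : 0 ≤ v - u)]

/-- `markedProb p` is Lipschitz with constant the mean of `p`. -/
lemma OffspringAssumption.markedProb_sub_le (hp : OffspringAssumption p)
    (hq : q ∈ Set.Icc (0 : ℝ) 1) (hr : r ∈ Set.Icc (0 : ℝ) 1) (hqr : q ≤ r) :
    markedProb p r - markedProb p q ≤ offspringMean p * (r - q) := by
  rw [markedProb, markedProb, offspringMean,
    ← (summable_markedProb p hr).tsum_sub (summable_markedProb p hq), ← tsum_mul_right]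
  refine ((summable_markedProb p hr).sub (summable_markedProb p hq)).tsum_le_tsum (fun k => ?_)
    (hp.summable_mean.mul_right _)
  have := pow_sub_pow_le (u := 1 - r) (v := 1 - q) (by linarith [hr.2]) (by linarith)
    (by linarith [hq.1]) k
  have h0 : 0 ≤ (p k).toReal := ENNReal.toReal_nonneg
  nlinarith

lemma markedProb_zero (p : PMF ℕ) : markedProb p 0 = 0 := by simp [markedProb]

lemma OffspringAssumption.markedProb_le (hp : OffspringAssumption p)
    (hq : q ∈ Set.Icc (0 : ℝ) 1) : markedProb p q ≤ offspringMean p * q := by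
  simpa [markedProb_zero] using hp.markedProb_sub_le (by simp) hq hq.1

lemma one_sub_pow_ge (hq : q ∈ Set.Icc (0 : ℝ) 1) (k : ℕ) :
    k * q - k ^ 2 * q ^ 2 ≤ 1 - (1 - q) ^ k := by
  obtain ⟨h0, h1⟩ := hq
  induction k with
  | zero => simp
  | succ k ih =>
    have hk : (0 : ℝ) ≤ k := by positivity
    have h2 : 1 - (1 - q) ^ k ≤ k * q := by
      simpa using pow_sub_pow_le (u := 1 - q) (v := 1) (by linarith) (by linarith) le_rfl k
    rw [pow_succ (1 - q)]
    push_cast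
    nlinarith [mul_le_mul_of_nonneg_left h2 h0, sq_nonneg q, mul_nonneg hk (sq_nonneg q)]

/-- Second-order lower bound (Bonferroni's inequality, with a non-optimal constant). -/
lemma OffspringAssumption.exists_markedProb_ge (hp : OffspringAssumption p) :
    ∃ C : ℝ, 0 ≤ C ∧ ∀ q ∈ Set.Icc (0 : ℝ) 1,
      offspringMean p * q - C * q ^ 2 ≤ markedProb p q := by
  refine ⟨∑' k : ℕ, (p k).toReal * (k : ℝ) ^ 2, tsum_nonneg fun k => by positivity,
    fun q hq => ?_⟩
  rw [markedProb, offspringMean, ← tsum_mul_right, ← tsum_mul_right,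
    ← (hp.summable_mean.mul_right _).tsum_sub (hp.summable_second.mul_right _)]
  refine ((hp.summable_mean.mul_right _).sub (hp.summable_second.mul_right _)).tsum_le_tsum
    (fun k => ?_) (summable_markedProb p hq)
  have := one_sub_pow_ge hq k
  have h0 : 0 ≤ (p k).toReal := ENNReal.toReal_nonneg
  nlinarith

end markedProb

end BRW

namespace BRW

/-! ### The recursion for the distribution of the maximum -/

/-- The solution of the recursion satisfied by `P(M_n ≥ x)` for an integer `x`: to reach a level
`x > 0` within `n + 1` generations, the initial particle jumps to some `y`, and then one of its
children has to reach a level higher by `x - y` within `n` generations. -/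
noncomputable def hitProb (a : PMF ℤ) (p : PMF ℕ) : ℕ → ℤ → ℝ
  | 0, x => if x ≤ 0 then 1 else 0
  | n + 1, x => if x ≤ 0 then 1 else ∑' y, (a y).toReal * markedProb p (hitProb a p n (x - y))

variable {a : PMF ℤ} {p : PMF ℕ}

lemma hitProb_of_nonpos {x : ℤ} (hx : x ≤ 0) (n : ℕ) : hitProb a p n x = 1 := by
  cases n <;> simp [hitProb, hx]

lemma hitProb_zero_of_pos {x : ℤ} (hx : 0 < x) : hitProb a p 0 x = 0 := by
  simp [hitProb, not_le.2 hx]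

lemma hitProb_succ_of_pos {x : ℤ} (hx : 0 < x) (n : ℕ) : hitProb a p (n + 1) x =
    ∑' y, (a y).toReal * markedProb p (hitProb a p n (x - y)) := by
  simp [hitProb, not_le.2 hx]

lemma summable_pmf_mul {ι : Type*} (a : PMF ι) {f : ι → ℝ} (hf : ∀ y, f y ∈ Set.Icc (0 : ℝ) 1) :
    Summable fun y => (a y).toReal * f y := by
  refine Summable.of_nonneg_of_le (fun y => ?_) (fun y => ?_) (hasSum_pmf a).summable
  · exact mul_nonneg ENNReal.toReal_nonneg (hf y).1
  · exact mul_le_of_le_one_right ENNReal.toReal_nonneg (hf y).2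

lemma tsum_pmf_mul_mem {ι : Type*} (a : PMF ι) {f : ι → ℝ} (hf : ∀ y, f y ∈ Set.Icc (0 : ℝ) 1) :
    ∑' y, (a y).toReal * f y ∈ Set.Icc (0 : ℝ) 1 := by
  refine ⟨tsum_nonneg fun y => mul_nonneg ENNReal.toReal_nonneg (hf y).1, ?_⟩
  rw [← (hasSum_pmf a).tsum_eq]
  exact (summable_pmf_mul a hf).tsum_le_tsum
    (fun y => mul_le_of_le_one_right ENNReal.toReal_nonneg (hf y).2) (hasSum_pmf a).summable

lemma hitProb_mem (n : ℕ) (x : ℤ) : hitProb a p n x ∈ Set.Icc (0 : ℝ) 1 := by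
  rcases le_or_gt x 0 with hx | hx
  · simp [hitProb_of_nonpos hx]
  induction n generalizing x with
  | zero => simp [hitProb_zero_of_pos hx]
  | succ n ih =>
    rw [hitProb_succ_of_pos hx]
    refine tsum_pmf_mul_mem a fun y => markedProb_mem p ?_
    rcases le_or_gt (x - y) 0 with hxy | hxy
    · simp [hitProb_of_nonpos hxy]
    · exact ih _ hxy

lemma summable_hitProb (n : ℕ) (x : ℤ) :
    Summable fun y => (a y).toReal * hitProb a p n (x - y) :=
  summable_pmf_mul a fun _ => hitProb_mem _ _

lemma summable_markedProb_hitProb (n : ℕ) (x : ℤ) :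
    Summable fun y => (a y).toReal * markedProb p (hitProb a p n (x - y)) :=
  summable_pmf_mul a fun _ => markedProb_mem p (hitProb_mem _ _)

lemma hitProb_le_succ (n : ℕ) (x : ℤ) : hitProb a p n x ≤ hitProb a p (n + 1) x := by
  rcases le_or_gt x 0 with hx | hx
  · simp [hitProb_of_nonpos hx]
  induction n generalizing x with
  | zero => rw [hitProb_zero_of_pos hx]; exact (hitProb_mem _ _).1
  | succ n ih =>
    rw [hitProb_succ_of_pos hx, hitProb_succ_of_pos hx]
    refine (summable_markedProb_hitProb n x).tsum_le_tsum (fun y => ?_)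
      (summable_markedProb_hitProb (n + 1) x)
    refine mul_le_mul_of_nonneg_left ?_ ENNReal.toReal_nonneg
    refine markedProb_mono p (hitProb_mem _ _) (hitProb_mem _ _) ?_
    rcases le_or_gt (x - y) 0 with hxy | hxy
    · simp [hitProb_of_nonpos hxy]
    · exact ih _ hxy

lemma hitProb_monotone (x : ℤ) : Monotone fun n => hitProb a p n x :=
  monotone_nat_of_le_succ fun n => hitProb_le_succ n x

/-- First-moment bound: discounting by the mean number of children, the particles perform a random
walk. -/
lemma hitProb_succ_le (hp : OffspringAssumption p) {x : ℤ} (hx : 0 < x) (n : ℕ) :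
    hitProb a p (n + 1) x ≤ offspringMean p * ∑' y, (a y).toReal * hitProb a p n (x - y) := by
  rw [hitProb_succ_of_pos hx, ← tsum_mul_left]
  refine (summable_markedProb_hitProb n x).tsum_le_tsum (fun y => ?_)
    ((summable_hitProb n x).mul_left _)
  have := hp.markedProb_le (hitProb_mem (a := a) (p := p) n (x - y))
  have h0 : 0 ≤ (a y).toReal := ENNReal.toReal_nonneg
  nlinarith

/-- For `m K(s) ≥ 1` the function `(m K(s)) ^ n * s ^ (-x)` is a supersolution of the recursion. -/
lemma hitProb_le_pow_mul_zpow (ha : JumpAssumption a) (hp : OffspringAssumption p) {s : ℝ}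
    (hs : 1 ≤ s) (hK : 1 ≤ offspringMean p * genFun a s) (n : ℕ) (x : ℤ) :
    hitProb a p n x ≤ (offspringMean p * genFun a s) ^ n * s ^ (-x) := by
  have hs0 : 0 < s := by linarith
  have hm := hp.mean_pos
  induction n generalizing x with
  | zero =>
    rcases le_or_gt x 0 with hx | hx
    · rw [hitProb_of_nonpos hx, pow_zero, one_mul]
      exact one_le_zpow₀ hs (by omega)
    · rw [hitProb_zero_of_pos hx]
      positivity
  | succ n ih =>
    rcases le_or_gt x 0 with hx | hx
    · rw [hitProb_of_nonpos hx]
      exact one_le_mul_of_one_le_of_one_le (one_le_pow₀ hK) (one_le_zpow₀ hs (by omega))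
    · refine (hitProb_succ_le hp hx n).trans ?_
      have h1 := (ha.hasSum_zpow_neg_sub hs x).mul_left ((offspringMean p * genFun a s) ^ n)
      have h2 := hasSum_le (fun y => ?_) (summable_hitProb (a := a) (p := p) n x).hasSum h1
      · calc _ ≤ offspringMean p * ((offspringMean p * genFun a s) ^ n *
              (genFun a s * s ^ (-x))) := mul_le_mul_of_nonneg_left h2 hm.le
          _ = _ := by ring
      · have h0 : 0 ≤ (a y).toReal := ENNReal.toReal_nonneg
        nlinarith [ih (x - y)]

/-- The probability that the level `x` is first reached after generation `n` is controlled by the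
expected number of particles beyond `x` after generation `n`. -/
lemma hitProb_add_sub_le (ha : JumpAssumption a) (hp : OffspringAssumption p) {ρ s : ℝ}
    (hρ : offspringMean p * genFun a ρ = 1) (hs : 1 ≤ s) (hsρ : s ≤ ρ) (j n : ℕ) (x : ℤ) :
    hitProb a p (n + j) x - hitProb a p n x
      ≤ (offspringMean p * genFun a s) ^ n * s ^ (-x) := by
  have hs0 : 0 < s := by linarith
  have hm := hp.mean_pos
  have hK : 0 ≤ genFun a s := tsum_nonneg fun y => by positivity
  induction n generalizing x with
  | zero =>
    rcases le_or_gt x 0 with hx | hx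
    · rw [hitProb_of_nonpos hx, hitProb_of_nonpos hx, sub_self]
      positivity
    · rw [hitProb_zero_of_pos hx, sub_zero, pow_zero, one_mul]
      refine (hitProb_le_pow_mul_zpow ha hp (hs.trans hsρ) hρ.ge _ x).trans ?_
      rw [hρ, one_pow, one_mul, zpow_neg, zpow_neg]
      gcongr
      exact zpow_le_zpow_left₀ hx.le hs0.le hsρ
  | succ n ih =>
    rcases le_or_gt x 0 with hx | hx
    · rw [hitProb_of_nonpos hx, hitProb_of_nonpos hx, sub_self]
      positivity
    · rw [show n + 1 + j = n + j + 1 by omega, hitProb_succ_of_pos hx, hitProb_succ_of_pos hx]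
      have h1 := (ha.hasSum_zpow_neg_sub hs x).mul_left
        (offspringMean p * (offspringMean p * genFun a s) ^ n)
      have h2 := (summable_markedProb_hitProb (a := a) (p := p) (n + j) x).hasSum.sub
        (summable_markedProb_hitProb (a := a) (p := p) n x).hasSum
      refine (hasSum_le (fun y => ?_) h2 h1).trans (le_of_eq (by ring))
      have h3 := hp.markedProb_sub_le (hitProb_mem (a := a) (p := p) n (x - y))
        (hitProb_mem (n + j) (x - y))
        (hitProb_monotone _ (by omega))
      have h4 := mul_le_mul_of_nonneg_left (ih (x - y)) hm.le
      have h0 : 0 ≤ (a y).toReal := ENNReal.toReal_nonneg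
      nlinarith

/-- Comparison principle: a subsolution of the recursion stays below its solution. -/
lemma max_le_hitProb {v : ℕ → ℤ → ℝ} (hv1 : ∀ n x, v n x ≤ 1) (hv0 : ∀ x, 0 < x → v 0 x ≤ 0)
    (hstep : ∀ n x, 0 < x →
      v (n + 1) x ≤ ∑' y, (a y).toReal * markedProb p (max (v n (x - y)) 0)) (n : ℕ) (x : ℤ) :
    max (v n x) 0 ≤ hitProb a p n x := by
  refine max_le ?_ (hitProb_mem n x).1
  rcases le_or_gt x 0 with hx | hx
  · rw [hitProb_of_nonpos hx]
    exact hv1 n x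
  induction n generalizing x with
  | zero => rw [hitProb_zero_of_pos hx]; exact hv0 x hx
  | succ n ih =>
    have hmem : ∀ x, max (v n x) 0 ∈ Set.Icc (0 : ℝ) 1 := fun x =>
      ⟨le_max_right _ _, max_le (hv1 n x) zero_le_one⟩
    rw [hitProb_succ_of_pos hx]
    refine (hstep n x hx).trans ?_
    refine (summable_pmf_mul a fun y => markedProb_mem p (hmem (x - y))).tsum_le_tsum (fun y => ?_)
      (summable_markedProb_hitProb n x)
    refine mul_le_mul_of_nonneg_left ?_ ENNReal.toReal_nonneg
    refine markedProb_mono p (hmem _) (hitProb_mem _ _) (max_le ?_ (hitProb_mem _ _).1)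
    rcases le_or_gt (x - y) 0 with hxy | hxy
    · rw [hitProb_of_nonpos hxy]
      exact hv1 _ _
    · exact ih _ hxy

lemma zpow_neg_anti {u w : ℝ} {x : ℤ} (hu : 0 < u) (huw : u ≤ w) (hx : 0 ≤ x) :
    w ^ (-x) ≤ u ^ (-x) := by
  rw [zpow_neg, zpow_neg]
  exact inv_anti₀ (by positivity) (zpow_le_zpow_left₀ hx hu.le huw)

lemma sq_zpow_eq (u : ℝ) (x : ℤ) : (u ^ 2) ^ x = (u ^ x) ^ 2 := by
  rw [← zpow_natCast, ← zpow_natCast, ← zpow_mul, ← zpow_mul, mul_comm]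

/-- Upper bounds for the profile of the subsolution below. -/
lemma profile_bounds {ρ s A : ℝ} (hρ1 : 1 < ρ) (hρs : ρ < s) (hsρ : s < ρ ^ 2) (hA : 0 < A)
    (x : ℤ) {v : ℝ} (hv : v ≤ ρ ^ (-x) + A * s ^ (-x) - (s ^ 2) ^ (-x)) :
    v ≤ (1 + A) ^ 2 ∧ max v 0 ^ 2 ≤ ((1 + A) ^ 2) ^ 2 * s ^ (-x) := by
  have hρ0 : 0 < ρ := by linarith
  have hs0 : 0 < s := by linarith
  have hV1 : 1 ≤ (1 + A) ^ 2 := by nlinarith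
  rw [sq_zpow_eq] at hv
  rcases le_total x 0 with hx | hx
  · have h1 : ρ ^ (-x) ≤ s ^ (-x) := zpow_le_zpow_left₀ (by omega) hρ0.le hρs.le
    have h2 : v ≤ (1 + A) ^ 2 := by nlinarith [sq_nonneg (s ^ (-x) - (1 + A) / 2)]
    have h3 : 1 ≤ s ^ (-x) := one_le_zpow₀ (by linarith) (by omega)
    have h4 : max v 0 ≤ (1 + A) ^ 2 := max_le h2 (by positivity)
    refine ⟨h2, ?_⟩
    calc max v 0 ^ 2 ≤ ((1 + A) ^ 2) ^ 2 := by gcongr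
      _ ≤ ((1 + A) ^ 2) ^ 2 * s ^ (-x) := le_mul_of_one_le_right (by positivity) h3
  · have h1 := zpow_neg_anti hρ0 hρs.le hx
    have h2 : ρ ^ (-x) ≤ 1 := zpow_le_one_of_nonpos₀ hρ1.le (by omega)
    have h3 : v ≤ (1 + A) * ρ ^ (-x) := by nlinarith [sq_nonneg (s ^ (-x))]
    have h4 : max v 0 ≤ (1 + A) * ρ ^ (-x) := max_le h3 (by positivity)
    have h5 : (ρ ^ (-x)) ^ 2 ≤ s ^ (-x) := by
      rw [← sq_zpow_eq]
      exact zpow_neg_anti hs0 hsρ.le hx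
    refine ⟨by nlinarith, ?_⟩
    calc max v 0 ^ 2 ≤ ((1 + A) * ρ ^ (-x)) ^ 2 := by gcongr
      _ = (1 + A) ^ 2 * (ρ ^ (-x)) ^ 2 := by ring
      _ ≤ ((1 + A) ^ 2) ^ 2 * s ^ (-x) :=
        mul_le_mul (by nlinarith) h5 (by positivity) (by positivity)

/-- A subsolution of the recursion. Next to the harmonic function `ρ ^ (-x)`, the term
`A s ^ (-x)` with `ρ < s < ρ²` pays for the quadratic part of the recursion, `s ^ (-2 x)` makes
the sum bounded above on the left half-line, and the last term, with `r < ρ`, makes it nonpositive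
on `x > 0` at time `0`, while along `x = c n` with small `c` it is negligible. -/
lemma exists_le_hitProb (ha : JumpAssumption a) (hp : OffspringAssumption p) {ρ r s : ℝ}
    (hρ1 : 1 < ρ) (hρ : offspringMean p * genFun a ρ = 1) (hr : 1 < r) (hrρ : r < ρ)
    (hρs : ρ < s) (hsρ : s < ρ ^ 2) :
    ∃ α G : ℝ, 0 < α ∧ ∀ (n : ℕ) (x : ℤ),
      α * (ρ ^ (-x) - (s ^ 2) ^ (-x) - G * (offspringMean p * genFun a r) ^ n * r ^ (-x))
        ≤ hitProb a p n x := by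
  have hm := hp.mean_pos
  have hs1 : 1 < s := hρ1.trans hρs
  have hs2 : s < s ^ 2 := by nlinarith
  have hr0 : 0 < r := by linarith
  have hρ0 : 0 < ρ := by linarith
  have hs0 : 0 < s := by linarith
  obtain ⟨C, hC, hΦ⟩ := hp.exists_markedProb_ge
  generalize hmdef : offspringMean p = m at *
  have hKs : 1 < m * genFun a s := by
    rw [← hρ]
    exact mul_lt_mul_of_pos_left (ha.genFun_strictMono hρ1.le hρs) hm
  have hKt : m * genFun a s < m * genFun a (s ^ 2) :=
    mul_lt_mul_of_pos_left (ha.genFun_strictMono hs1.le hs2) hm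
  have hKs0 : 0 < genFun a s := by
    by_contra! h
    nlinarith
  have hKr : 0 ≤ genFun a r := tsum_nonneg fun y => by positivity
  obtain ⟨A, hA0, hA⟩ : ∃ A : ℝ, 0 < A ∧
      A * (m * genFun a s - 1) = 2 * (m * genFun a (s ^ 2) - 1) :=
    ⟨2 * (m * genFun a (s ^ 2) - 1) / (m * genFun a s - 1), div_pos (by linarith) (by linarith),
      div_mul_cancel₀ _ (by linarith)⟩
  -- `α` is so small that the subsolution is at most `1` and its quadratic part is negligible.
  obtain ⟨α, hα0, hαV, hαC⟩ : ∃ α : ℝ, 0 < α ∧ α * (1 + A) ^ 2 ≤ 1 ∧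
      α * (C * ((1 + A) ^ 2) ^ 2 * genFun a s) ≤ m * genFun a (s ^ 2) - 1 := by
    have h1 : 0 < m * genFun a (s ^ 2) - 1 := by linarith
    have h2 : 0 ≤ C * ((1 + A) ^ 2) ^ 2 * genFun a s := by positivity
    refine ⟨min ((1 + A) ^ 2)⁻¹
      ((m * genFun a (s ^ 2) - 1) / (C * ((1 + A) ^ 2) ^ 2 * genFun a s + 1)),
      lt_min (by positivity) (by positivity), ?_, ?_⟩
    · refine (mul_le_mul_of_nonneg_right (min_le_left _ _) (by positivity)).trans ?_
      rw [inv_mul_cancel₀ (by positivity)]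
    · refine (mul_le_mul_of_nonneg_right (min_le_right _ _) h2).trans ?_
      rw [div_mul_eq_mul_div, div_le_iff₀ (by positivity)]
      nlinarith
  have hG : ∀ (n : ℕ) (x : ℤ), 0 ≤ (1 + A) * (m * genFun a r) ^ n * r ^ (-x) :=
    fun n x => by positivity
  generalize hv : (fun (n : ℕ) (x : ℤ) => ρ ^ (-x) + A * s ^ (-x) - (s ^ 2) ^ (-x)
    - (1 + A) * (m * genFun a r) ^ n * r ^ (-x)) = v
  have hv' : ∀ n x, v n x = ρ ^ (-x) + A * s ^ (-x) - (s ^ 2) ^ (-x)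
    - (1 + A) * (m * genFun a r) ^ n * r ^ (-x) := fun n x => by rw [← hv]
  have hvb := fun n x => profile_bounds hρ1 hρs hsρ hA0 x (v := v n x)
    (by rw [hv']; linarith [hG n x])
  have hvsum : ∀ n x, HasSum (fun y : ℤ => (a y).toReal * v n (x - y))
      (genFun a ρ * ρ ^ (-x) + A * (genFun a s * s ^ (-x)) - genFun a (s ^ 2) * (s ^ 2) ^ (-x)
        - (1 + A) * (m * genFun a r) ^ n * (genFun a r * r ^ (-x))) := fun n x => by
    refine ((((ha.hasSum_zpow_neg_sub hρ1.le x).add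
      ((ha.hasSum_zpow_neg_sub hs1.le x).mul_left A)).sub
      (ha.hasSum_zpow_neg_sub (by nlinarith : 1 ≤ s ^ 2) x)).sub
      ((ha.hasSum_zpow_neg_sub hr.le x).mul_left ((1 + A) * (m * genFun a r) ^ n))).congr_fun
      fun y => ?_
    rw [hv']
    ring
  have hα1 : ∀ n x, α * v n x ≤ 1 := fun n x =>
    (mul_le_mul_of_nonneg_left (hvb n x).1 hα0.le).trans hαV
  have hmax : ∀ n x, max (α * v n x) 0 = α * max (v n x) 0 := fun n x => by
    rw [mul_max_of_nonneg _ _ hα0.le, mul_zero]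
  have hmem : ∀ n x, max (α * v n x) 0 ∈ Set.Icc (0 : ℝ) 1 := fun n x =>
    ⟨le_max_right _ _, max_le (hα1 n x) zero_le_one⟩
  have key := max_le_hitProb (a := a) (p := p) (v := fun n x => α * v n x) hα1
    (fun x hx => ?_) fun n x hx => ?_
  · refine ⟨α, 1 + A, hα0, fun n x => le_trans ?_ (key n x)⟩
    refine le_max_of_le_left (mul_le_mul_of_nonneg_left ?_ hα0.le)
    have : 0 ≤ A * s ^ (-x) := by positivity
    rw [hv']
    linarith
  · refine mul_nonpos_of_nonneg_of_nonpos hα0.le ?_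
    have h2 := zpow_neg_anti hr0 hrρ.le hx.le
    have h3 := mul_le_mul_of_nonneg_left ((zpow_neg_anti hρ0 hρs.le hx.le).trans h2) hA0.le
    have h4 : 0 ≤ (s ^ 2) ^ (-x) := by positivity
    rw [hv', pow_zero]
    linarith
  · have h1 := ((hvsum n x).mul_left (m * α)).sub
      ((ha.hasSum_zpow_neg_sub hs1.le x).mul_left (C * (α ^ 2 * ((1 + A) ^ 2) ^ 2)))
    have h2 := hasSum_le (fun y => ?_) h1
      (summable_pmf_mul a fun y => markedProb_mem p (hmem n (x - y))).hasSum
    · refine le_trans ?_ h2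
      have h3 := zpow_neg_anti hs0 hs2.le hx.le
      have h4 : 0 < s ^ (-x) := by positivity
      have h5 := mul_le_mul_of_nonneg_right hαC h4.le
      have h6 := mul_le_mul_of_nonneg_left h3 (by linarith : 0 ≤ m * genFun a (s ^ 2) - 1)
      have h7 : 0 ≤ α * (A * (m * genFun a s - 1) * s ^ (-x)
          - α * (C * ((1 + A) ^ 2) ^ 2 * genFun a s) * s ^ (-x)
          - (m * genFun a (s ^ 2) - 1) * (s ^ 2) ^ (-x)) := by
        refine mul_nonneg hα0.le ?_
        rw [hA]
        linarith
      refine sub_nonneg.1 (h7.trans (le_of_eq ?_))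
      rw [hv', pow_succ]
      linear_combination α * ρ ^ (-x) * (-hρ)
    · have h3 := hΦ _ (hmem n (x - y))
      have h4 : m * (α * v n (x - y)) ≤ m * max (α * v n (x - y)) 0 :=
        mul_le_mul_of_nonneg_left (le_max_left _ _) hm.le
      have h5 : C * max (α * v n (x - y)) 0 ^ 2
          ≤ C * (α ^ 2 * (((1 + A) ^ 2) ^ 2 * s ^ (-(x - y)))) := by
        rw [hmax, mul_pow]
        exact mul_le_mul_of_nonneg_left
          (mul_le_mul_of_nonneg_left (hvb n (x - y)).2 (by positivity)) hC
      have h0 : 0 ≤ (a y).toReal := ENNReal.toReal_nonneg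
      have h6 := mul_le_mul_of_nonneg_left ((sub_le_sub h4 h5).trans h3) h0
      refine le_trans (le_of_eq ?_) h6
      ring

/-! ### The probability of ever reaching a level -/

/-- The limit of `hitProb a p n x` as `n → ∞`. -/
noncomputable def hitProbEver (a : PMF ℤ) (p : PMF ℕ) (x : ℤ) : ℝ := ⨆ n, hitProb a p n x

lemma tendsto_hitProb (x : ℤ) :
    Tendsto (fun n => hitProb a p n x) atTop (𝓝 (hitProbEver a p x)) :=
  tendsto_atTop_ciSup (hitProb_monotone x) ⟨1, by rintro _ ⟨n, rfl⟩; exact (hitProb_mem n x).2⟩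

lemma hitProb_le_hitProbEver (n : ℕ) (x : ℤ) : hitProb a p n x ≤ hitProbEver a p x :=
  (hitProb_monotone x).ge_of_tendsto (tendsto_hitProb x) n

lemma hitProbEver_mem (x : ℤ) : hitProbEver a p x ∈ Set.Icc (0 : ℝ) 1 :=
  isClosed_Icc.mem_of_tendsto (tendsto_hitProb x) (Eventually.of_forall fun n => hitProb_mem n x)

lemma hitProbEver_le_zpow (ha : JumpAssumption a) (hp : OffspringAssumption p) {ρ : ℝ}
    (hρ1 : 1 < ρ) (hρ : offspringMean p * genFun a ρ = 1) (x : ℤ) :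
    hitProbEver a p x ≤ ρ ^ (-x) :=
  le_of_tendsto' (tendsto_hitProb x) fun n => by
    simpa [hρ] using hitProb_le_pow_mul_zpow ha hp hρ1.le hρ.ge n x

lemma hitProbEver_sub_le (ha : JumpAssumption a) (hp : OffspringAssumption p) {ρ s : ℝ}
    (hρ : offspringMean p * genFun a ρ = 1) (hs : 1 ≤ s) (hsρ : s ≤ ρ) (n : ℕ) (x : ℤ) :
    hitProbEver a p x - hitProb a p n x ≤ (offspringMean p * genFun a s) ^ n * s ^ (-x) := by
  refine le_of_tendsto' (((tendsto_add_atTop_iff_nat n).2 (tendsto_hitProb x)).sub_const _)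
    fun j => ?_
  rw [add_comm]
  exact hitProb_add_sub_le ha hp hρ hs hsρ j n x

lemma summable_hitProbEver (x : ℤ) :
    Summable fun y => (a y).toReal * hitProbEver a p (x - y) :=
  summable_pmf_mul a fun _ => hitProbEver_mem _

lemma hitProbEver_le (hp : OffspringAssumption p) {x : ℤ} (hx : 0 < x) :
    hitProbEver a p x ≤ offspringMean p * ∑' y, (a y).toReal * hitProbEver a p (x - y) := by
  refine le_of_tendsto' ((tendsto_add_atTop_iff_nat 1).2 (tendsto_hitProb x)) fun n => ?_
  refine (hitProb_succ_le hp hx n).trans (mul_le_mul_of_nonneg_left ?_ hp.mean_pos.le)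
  exact (summable_hitProb n x).tsum_le_tsum (fun y => mul_le_mul_of_nonneg_left
    (hitProb_le_hitProbEver _ _) ENNReal.toReal_nonneg) (summable_hitProbEver x)

lemma hitProbEver_eq (hp : OffspringAssumption p) {x : ℤ} (hx : 0 < x) :
    hitProbEver a p x = ∑' y, (a y).toReal * markedProb p (hitProbEver a p (x - y)) := by
  refine tendsto_nhds_unique ((tendsto_add_atTop_iff_nat 1).2 (tendsto_hitProb x)) ?_
  simp only [hitProb_succ_of_pos hx]
  refine tendsto_tsum_of_dominated_convergence (hasSum_pmf a).summable (fun y => ?_)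
    (Eventually.of_forall fun n y => ?_)
  · refine Tendsto.const_mul _ ?_
    have h1 : Tendsto (fun n => markedProb p (hitProbEver a p (x - y))
        - offspringMean p * (hitProbEver a p (x - y) - hitProb a p n (x - y))) atTop
        (𝓝 (markedProb p (hitProbEver a p (x - y)) - offspringMean p *
          (hitProbEver a p (x - y) - hitProbEver a p (x - y)))) :=
      ((tendsto_hitProb (x - y)).const_sub _ |>.const_mul _).const_sub _
    rw [sub_self, mul_zero, sub_zero] at h1
    refine tendsto_of_tendsto_of_tendsto_of_le_of_le h1 tendsto_const_nhds (fun n => ?_)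
      fun n => ?_
    · have := hp.markedProb_sub_le (hitProb_mem (a := a) (p := p) n (x - y))
        (hitProbEver_mem (x - y))
        (hitProb_le_hitProbEver n (x - y))
      simp only
      linarith
    · exact markedProb_mono p (hitProb_mem _ _) (hitProbEver_mem _) (hitProb_le_hitProbEver _ _)
  · have h1 := markedProb_mem p (hitProb_mem (a := a) (p := p) n (x - y))
    rw [Real.norm_of_nonneg (mul_nonneg ENNReal.toReal_nonneg h1.1)]
    exact mul_le_of_le_one_right ENNReal.toReal_nonneg h1.2

/-- The error in the first-moment bound is quadratic, hence of smaller exponential order. -/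
lemma exists_hitProbEver_ge (ha : JumpAssumption a) (hp : OffspringAssumption p) {ρ s : ℝ}
    (hρ1 : 1 < ρ) (hρ : offspringMean p * genFun a ρ = 1) (hs : 1 < s) (hsρ : s ≤ ρ ^ 2) :
    ∃ B : ℝ, 0 ≤ B ∧ ∀ x : ℤ, 0 < x →
      offspringMean p * ∑' y, (a y).toReal * hitProbEver a p (x - y) - B * s ^ (-x)
        ≤ hitProbEver a p x := by
  obtain ⟨C, hC, hΦ⟩ := hp.exists_markedProb_ge
  have hs0 : 0 < s := by linarith
  have hρ0 : 0 < ρ := by linarith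
  have hK : 0 ≤ genFun a s := tsum_nonneg fun y => by positivity
  refine ⟨C * genFun a s, by positivity, fun x hx => ?_⟩
  have hsq : ∀ t : ℤ, hitProbEver a p t ^ 2 ≤ s ^ (-t) := fun t => by
    have h0 := hitProbEver_mem (a := a) (p := p) t
    rcases le_total t 0 with ht | ht
    · have h1 : 1 ≤ s ^ (-t) := one_le_zpow₀ hs.le (by omega)
      exact (pow_le_one₀ h0.1 h0.2).trans h1
    · calc hitProbEver a p t ^ 2 ≤ (ρ ^ (-t)) ^ 2 :=
            pow_le_pow_left₀ h0.1 (hitProbEver_le_zpow ha hp hρ1 hρ t) 2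
        _ = (ρ ^ 2) ^ (-t) := by
          rw [← zpow_natCast, ← zpow_natCast, ← zpow_mul, ← zpow_mul, mul_comm]
        _ ≤ s ^ (-t) := by
          rw [zpow_neg, zpow_neg]
          exact inv_anti₀ (by positivity) (zpow_le_zpow_left₀ ht hs0.le hsρ)
  rw [hitProbEver_eq hp hx]
  have h1 := ((summable_hitProbEver (a := a) (p := p) x).hasSum.mul_left (offspringMean p)).sub
    ((ha.hasSum_zpow_neg_sub hs.le x).mul_left C)
  rw [mul_assoc]
  refine hasSum_le (fun y => ?_) h1
    (summable_pmf_mul a fun y => markedProb_mem p (hitProbEver_mem (x - y))).hasSum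
  have h2 := hΦ _ (hitProbEver_mem (a := a) (p := p) (x - y))
  have h3 := mul_le_mul_of_nonneg_left (hsq (x - y)) hC
  have h0 : 0 ≤ (a y).toReal := ENNReal.toReal_nonneg
  nlinarith

end BRW

namespace BRW

/-! ### Convergence of almost harmonic functions of a walk with positive drift -/

/-- The averages `∑ b_y u(x - y)` make sense for a bounded function `u`. -/
lemma summable_mul_comp_sub {b u : ℤ → ℝ} (hb : ∀ y, 0 ≤ b y) (hb1 : Summable b) {B : ℝ}
    (hu : ∀ x, |u x| ≤ B) (x : ℤ) : Summable fun y => b y * u (x - y) := by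
  refine Summable.of_norm_bounded (hb1.mul_right B) fun y => ?_
  rw [Real.norm_eq_abs, abs_mul, abs_of_nonneg (hb y)]
  exact mul_le_mul_of_nonneg_left (hu _) (hb y)

/-- Minimum principle. A walk with positive drift, viewed from a level that it has to pass and
which it cannot jump over, visits the window `(x₀ - R, x₀]` of distances. So a bounded
superharmonic function on the distances beyond `x₀` is bounded below by its minimum over the
window. -/
lemma minimum_principle {b z : ℤ → ℝ} {R : ℕ} {D B β : ℝ} {x₀ : ℤ}
    (hb : ∀ y, 0 ≤ b y) (hb1 : HasSum b 1) (hbR : ∀ y : ℤ, (R : ℤ) < y → b y = 0) (hD : 0 < D)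
    (hbD : HasSum (fun y : ℤ => b y * (y : ℝ)) D) (hzB : ∀ x, x₀ - R < x → -B ≤ z x)
    (hsum : ∀ x, x₀ < x → Summable fun y => b y * z (x - y))
    (hsup : ∀ x, x₀ < x → ∑' y, b y * z (x - y) ≤ z x)
    (hwin : ∀ x, x₀ - R < x → x ≤ x₀ → β ≤ z x) {x : ℤ} (hx : x₀ - R < x) : β ≤ z x := by
  by_contra! hlt
  have hxpos : (0 : ℝ) < x - x₀ + R := by
    have : (0 : ℤ) < x - x₀ + R := by omega
    exact_mod_cast this
  -- A small multiple of the distance, which is strictly superharmonic because of the drift.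
  set δ : ℝ := (β - z x) / (2 * (x - x₀ + R)) with hδ
  have hδ0 : 0 < δ := div_pos (by linarith) (by linarith)
  set w : ℤ → ℝ := fun t => z t + δ * (t - x₀ + R) with hw
  have hwx : w x < β := by
    have : δ * (x - x₀ + R) = (β - z x) / 2 := by
      rw [hδ]; field_simp
    simp only [hw, this]
    linarith
  obtain ⟨T, hT⟩ := exists_nat_gt ((β + B) / δ + x₀)
  have hfin : {t : ℤ | x₀ - R < t ∧ w t ≤ w x}.Finite := by
    refine (Set.finite_Icc (x₀ - R) T).subset fun t ht => ⟨ht.1.le, ?_⟩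
    by_contra! htT
    have h1 := hzB t ht.1
    have h2 : w t < β := ht.2.trans_lt hwx
    have h3 : (β + B) / δ + x₀ < t := hT.trans (by exact_mod_cast htT)
    have h4 : β + B < δ * (t - x₀) := by
      rw [mul_comm]
      exact (div_lt_iff₀ hδ0).1 (by linarith)
    have h5 : 0 ≤ δ * R := by positivity
    simp only [hw] at h2
    nlinarith
  obtain ⟨t, ht, hmin⟩ := Set.exists_min_image _ w hfin ⟨x, hx, le_rfl⟩
  have hmin' : ∀ t', x₀ - R < t' → w t ≤ w t' := fun t' ht' => by
    by_cases h : w t' ≤ w x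
    · exact hmin t' ⟨ht', h⟩
    · exact ht.2.trans (not_le.1 h).le
  have htx : x₀ < t := by
    by_contra! h
    have h1 := hwin t ht.1 h
    have h2 := ht.2.trans_lt hwx
    have h3 : (0 : ℝ) ≤ t - x₀ + R := by
      have : (0 : ℤ) ≤ t - x₀ + R := by have := ht.1; omega
      exact_mod_cast this
    simp only [hw] at h2
    nlinarith
  have hws : HasSum (fun y => b y * w (t - y))
      (∑' y, b y * z (t - y) + δ * (t - x₀ + R) - δ * D) := by
    have h1 := (hsum t htx).hasSum
    have h2 := hb1.mul_right (δ * (t - x₀ + R))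
    have h3 := hbD.mul_left δ
    rw [one_mul] at h2
    refine ((h1.add h2).sub h3).congr_fun fun y => ?_
    simp only [hw]
    push_cast
    ring
  have hge : w t ≤ ∑' y, b y * z (t - y) + δ * (t - x₀ + R) - δ * D := by
    have h1 := hb1.mul_right (w t)
    rw [one_mul] at h1
    refine hasSum_le (fun y => ?_) h1 hws
    rcases le_or_gt y R with hy | hy
    · exact mul_le_mul_of_nonneg_left (hmin' _ (by omega)) (hb y)
    · simp [hbR y hy]
  have h1 := hsup t htx
  have h2 : 0 < δ * D := by positivity
  have hwt : w t = z t + δ * (t - x₀ + R) := rfl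
  linarith

/-- Suppose that the walk with step law `b` has positive drift and steps bounded above by `R`,
and makes steps of size `1`. A bounded function that is harmonic for it up to an exponentially
small error converges at infinity: near-maximal values propagate to the left by steps of size
`1`, and by the minimum principle a window of near-maximal values propagates to the right. -/
lemma exists_tendsto_of_almost_harmonic {b u : ℤ → ℝ} {R : ℕ} {D B r k : ℝ}
    (hb : ∀ y, 0 ≤ b y) (hb1 : HasSum b 1) (hbR : ∀ y : ℤ, (R : ℤ) < y → b y = 0) (hD : 0 < D)
    (hbD : HasSum (fun y : ℤ => b y * (y : ℝ)) D) (hb_one : 0 < b 1) (hr : 1 < r)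
    (hk : HasSum (fun y : ℤ => b y * r ^ y) k) (hk1 : 1 < k) (hB : 0 ≤ B)
    (hu0 : ∀ x, 0 ≤ u x) (hu1 : ∀ x, u x ≤ 1)
    (hsub : ∀ x, 0 < x → u x ≤ ∑' y, b y * u (x - y))
    (hsup : ∀ x, 0 < x → ∑' y, b y * u (x - y) ≤ u x + B * r ^ (-x)) :
    ∃ κ, Tendsto u atTop (𝓝 κ) := by
  have hr0 : 0 < r := by linarith
  have hR1 : (1 : ℤ) ≤ R := by
    by_contra! h
    exact hb_one.ne' (hbR 1 h)
  have hus : ∀ x, Summable fun y => b y * u (x - y) := fun x =>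
    summable_mul_comp_sub hb hb1.summable (B := 1)
      (fun x => by rw [abs_of_nonneg (hu0 x)]; exact hu1 x) x
  have hbdd : IsBoundedUnder (· ≤ ·) atTop u := isBoundedUnder_of ⟨1, hu1⟩
  have hbdd' : IsBoundedUnder (· ≥ ·) atTop u := isBoundedUnder_of ⟨0, hu0⟩
  set L := limsup u atTop with hL
  have hb11 : b 1 ≤ 1 := by
    rw [← hb1.tsum_eq]
    exact hb1.summable.le_tsum 1 fun y _ => hb y
  -- Near-maximal values propagate to the left.
  have hleft : ∀ j : ℕ, ∀ ε > 0, ∃ η > 0, ∀ᶠ x in atTop, L - η ≤ u x →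
      ∀ i : ℕ, i ≤ j → L - ε ≤ u (x - i) := by
    intro j
    induction j with
    | zero =>
      intro ε hε
      refine ⟨ε, hε, Eventually.of_forall fun x hx i hi => ?_⟩
      obtain rfl : i = 0 := by omega
      simpa using hx
    | succ j ih =>
      intro ε hε
      obtain ⟨η', hη', hev'⟩ := ih (ε * b 1 / 2) (by positivity)
      have hη : 0 < min η' (ε * b 1 / 2) := lt_min hη' (by positivity)
      refine ⟨min η' (ε * b 1 / 2), hη, ?_⟩
      have hlt : ∀ᶠ x in atTop, u x < L + ε * b 1 / 2 :=
        eventually_lt_of_limsup_lt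
          (by simp only [← hL]; linarith [(by positivity : 0 < ε * b 1 / 2)]) hbdd
      obtain ⟨X, hX⟩ := eventually_atTop.1 hlt
      filter_upwards [hev', eventually_ge_atTop (X + R + j), eventually_gt_atTop (j : ℤ)]
        with x hx hxX hxj hux i hi
      have hprev := hx (by linarith [min_le_left η' (ε * b 1 / 2)])
      rcases Nat.lt_or_ge i (j + 1) with hi' | hi'
      · have := hprev i (by omega)
        nlinarith
      obtain rfl : i = j + 1 := by omega
      have hj := hprev j le_rfl
      -- Average at `x - j`: all the other terms are at most `L + ε b₁ / 2`.
      have h1 := hsub (x - j) (by omega)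
      have h2 : HasSum (fun y => b y * (L + ε * b 1 / 2)
          + if y = 1 then b 1 * (u (x - j - 1) - (L + ε * b 1 / 2)) else 0)
          (1 * (L + ε * b 1 / 2) + b 1 * (u (x - j - 1) - (L + ε * b 1 / 2))) :=
        (hb1.mul_right _).add (hasSum_ite_eq 1 _)
      have h3 := hasSum_le (fun y => ?_) (hus (x - j)).hasSum h2
      · have h4 : x - (j + 1 : ℕ) = x - j - 1 := by push_cast; ring
        rw [h4]
        have h5 : b 1 * (L - ε) ≤ b 1 * u (x - j - 1) := by
          nlinarith [(by positivity : 0 ≤ b 1 * (ε * b 1 / 2))]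
        exact le_of_mul_le_mul_left h5 hb_one
      · by_cases hy : y = 1
        · subst hy
          simp only [if_true]
          linarith
        · simp only [hy, if_false, add_zero]
          rcases le_or_gt y R with hyR | hyR
          · exact mul_le_mul_of_nonneg_left (hX _ (by omega)).le (hb y)
          · simp [hbR y hyR]
  -- By the minimum principle they propagate to the right.
  set A := B / (k - 1) with hA
  have hA0 : 0 ≤ A := div_nonneg hB (by linarith)
  have hliminf : ∀ ε > 0, ∀ᶠ x in atTop, L - ε ≤ u x := by
    intro ε hε
    obtain ⟨η, hη, hev⟩ := hleft R (ε / 2) (by positivity)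
    have hfreq : ∃ᶠ x in atTop, L - η < u x :=
      frequently_lt_of_lt_limsup hbdd'.isCoboundedUnder_le (by simp only [← hL]; linarith)
    have hsmall : ∀ᶠ x : ℤ in atTop, A * r ^ (-(x - R)) < ε / 2 := by
      have h1 : Tendsto (fun n : ℕ => A * r⁻¹ ^ n) atTop (𝓝 (A * 0)) :=
        (tendsto_pow_atTop_nhds_zero_of_lt_one (by positivity)
          (inv_lt_one_of_one_lt₀ hr)).const_mul A
      rw [mul_zero] at h1
      obtain ⟨n, hn⟩ := (h1.eventually (gt_mem_nhds (by positivity : 0 < ε / 2))).exists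
      filter_upwards [eventually_ge_atTop (n + R : ℤ)] with x hx
      refine lt_of_le_of_lt ?_ hn
      gcongr
      rw [inv_pow, ← zpow_natCast, ← zpow_neg]
      exact zpow_le_zpow_right₀ hr.le (by omega)
    obtain ⟨x₀, hx₀, hx₀', hxs, hxp⟩ := (hfreq.and_eventually
      (hev.and (hsmall.and (eventually_gt_atTop (R : ℤ))))).exists
    have hwin := hx₀' hx₀.le
    have hrs : ∀ x : ℤ, HasSum (fun y => b y * r ^ (-(x - y))) (k * r ^ (-x)) := fun x => by
      refine (hk.mul_right (r ^ (-x))).congr_fun fun y => ?_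
      rw [mul_assoc, ← zpow_add₀ hr0.ne']
      congr 2
      ring
    have hzs : ∀ x, HasSum (fun y => b y * (u (x - y) - A * r ^ (-(x - y))))
        (∑' y, b y * u (x - y) - A * (k * r ^ (-x))) := fun x => by
      refine ((hus x).hasSum.sub ((hrs x).mul_left A)).congr_fun fun y => ?_
      ring
    have hsm : ∀ x, x₀ - R < x → A * r ^ (-x) ≤ ε / 2 := fun x hx => by
      refine le_trans ?_ hxs.le
      refine mul_le_mul_of_nonneg_left (zpow_le_zpow_right₀ hr.le (by omega)) hA0
    filter_upwards [eventually_gt_atTop (x₀ - R)] with x hx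
    have hmp := minimum_principle (z := fun x => u x - A * r ^ (-x)) (β := L - ε) (B := ε / 2)
      (x₀ := x₀) hb hb1 hbR hD hbD (fun x hx => ?_) (fun x _ => (hzs x).summable)
      (fun x hx => ?_) (fun x hx hx' => ?_) hx
    · have : 0 ≤ A * r ^ (-x) := by positivity
      linarith
    · linarith [hu0 x, hsm x hx]
    · rw [(hzs x).tsum_eq]
      have h1 := hsup x (by omega)
      have h2 : A * (k * r ^ (-x)) = A * r ^ (-x) + B * r ^ (-x) := by
        have : A * k = A + B := by
          have : k - 1 ≠ 0 := by linarith
          rw [hA]; field_simp; ring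
        rw [← mul_assoc, this]; ring
      linarith
    · have h1 := hwin (x₀ - x).toNat (by omega)
      have h2 : x₀ - ((x₀ - x).toNat : ℤ) = x := by omega
      rw [h2] at h1
      linarith [hsm x hx]
  refine ⟨L, tendsto_of_le_liminf_of_limsup_le ?_ le_rfl hbdd hbdd'⟩
  refine le_of_forall_pos_le_add fun ε hε => ?_
  have := le_liminf_of_le hbdd.isCoboundedUnder_ge (hliminf ε hε)
  linarith

end BRW

namespace BRW

/-! ### The events of reaching a level -/

variable {Ω : Type*} {ξ : Vertex → Ω → ℤ} {N : Vertex → Ω → ℕ}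

/-- The event that some particle of the generations `0, …, n` sits at or beyond `x`. -/
def hitEvent (ξ : Vertex → Ω → ℤ) (N : Vertex → Ω → ℕ) (n : ℕ) (x : ℤ) : Set Ω :=
  {ω | ∃ v, InTree N ω v ∧ v.length ≤ n ∧ x ≤ position ξ ω v}

/-- The process that starts from the `i`-th child of the initial particle: its particle `v` is the
particle `v ++ [i]` of the full process. -/
def shift {β : Type*} (i : ℕ) (X : Vertex → Ω → β) : Vertex → Ω → β := fun v => X (v ++ [i])

lemma inTree_append_singleton (ω : Ω) (i : ℕ) (v : Vertex) :
    InTree N ω (v ++ [i]) ↔ i < N [] ω ∧ InTree (shift i N) ω v := by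
  induction v with
  | nil => simp [InTree]
  | cons j v ih => simp [InTree, ih, shift, and_assoc]

lemma position_append_singleton (ω : Ω) (i : ℕ) (v : Vertex) :
    position ξ ω (v ++ [i]) = ξ [] ω + position (shift i ξ) ω v := by
  induction v with
  | nil => simp [position]
  | cons j v ih => simp [position, ih, shift, add_assoc]

lemma le_iSup_position_iff (T : Set Vertex) (ω : Ω) (x : ℝ) :
    (x : EReal) ≤ ⨆ v ∈ T, ((position ξ ω v : ℝ) : EReal) ↔ ∃ v ∈ T, ⌈x⌉ ≤ position ξ ω v := by
  constructor
  · intro h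
    by_contra! hlt
    have h1 : (⨆ v ∈ T, ((position ξ ω v : ℝ) : EReal)) ≤ (((⌈x⌉ - 1 : ℤ) : ℝ) : EReal) := by
      refine iSup₂_le fun v hv => ?_
      have := hlt v hv
      exact EReal.coe_le_coe_iff.2 (by exact_mod_cast (by omega : position ξ ω v ≤ ⌈x⌉ - 1))
    have h2 := EReal.coe_le_coe_iff.1 (h.trans h1)
    have h3 := Int.ceil_lt_add_one x
    push_cast at h2
    linarith
  · rintro ⟨v, hv, h⟩
    refine le_iSup₂_of_le v hv (EReal.coe_le_coe_iff.2 ?_)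
    exact (Int.le_ceil x).trans (by exact_mod_cast h)

lemma setOf_le_maxUpTo (n : ℕ) (x : ℝ) :
    {ω | (x : EReal) ≤ maxUpTo ξ N n ω} = hitEvent ξ N n ⌈x⌉ := by
  ext ω
  refine (le_iSup_position_iff {v : Vertex | InTree N ω v ∧ v.length ≤ n} ω x).trans ?_
  simp [hitEvent, and_assoc]

lemma setOf_le_maxEver (x : ℝ) :
    {ω | (x : EReal) ≤ maxEver ξ N ω} = ⋃ n, hitEvent ξ N n ⌈x⌉ := by
  ext ω
  have h : maxEver ξ N ω = ⨆ v ∈ {v : Vertex | InTree N ω v}, ((position ξ ω v : ℝ) : EReal) := by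
    refine le_antisymm (iSup_le fun n => iSup₂_le fun v hv => le_iSup₂_of_le v hv.1 le_rfl)
      (iSup₂_le fun v hv => le_iSup_of_le v.length (le_iSup₂_of_le v ⟨hv, le_rfl⟩ le_rfl))
  change (x : EReal) ≤ maxEver ξ N ω ↔ _
  rw [h, le_iSup_position_iff, Set.mem_iUnion]
  exact ⟨fun ⟨v, h1, h2⟩ => ⟨v.length, v, h1, le_rfl, h2⟩, fun ⟨_, v, h1, _, h2⟩ => ⟨v, h1, h2⟩⟩

lemma hitEvent_of_nonpos {x : ℤ} (hx : x ≤ 0) (n : ℕ) : hitEvent ξ N n x = Set.univ :=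
  Set.eq_univ_of_forall fun _ => ⟨[], trivial, by simp, hx⟩

lemma hitEvent_zero_of_pos {x : ℤ} (hx : 0 < x) : hitEvent ξ N 0 x = ∅ := by
  refine Set.eq_empty_of_forall_notMem fun ω => ?_
  rintro ⟨v, -, hv, h⟩
  obtain rfl : v = [] := List.length_eq_zero_iff.1 (by omega)
  simp only [position] at h
  omega

lemma mem_hitEvent_succ_iff {x : ℤ} (hx : 0 < x) (n : ℕ) (ω : Ω) :
    ω ∈ hitEvent ξ N (n + 1) x ↔
      ∃ i < N [] ω, ω ∈ hitEvent (shift i ξ) (shift i N) n (x - ξ [] ω) := by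
  constructor
  · rintro ⟨v, h1, h2, h3⟩
    rcases List.eq_nil_or_concat' v with rfl | ⟨w, i, rfl⟩
    · simp only [position] at h3
      omega
    · rw [inTree_append_singleton] at h1
      rw [position_append_singleton] at h3
      simp only [List.length_append, List.length_singleton] at h2
      exact ⟨i, h1.1, w, h1.2, by omega, by omega⟩
  · rintro ⟨i, hi, w, h1, h2, h3⟩
    refine ⟨w ++ [i], (inTree_append_singleton ω i w).2 ⟨hi, h1⟩, by simpa using h2, ?_⟩
    rw [position_append_singleton]
    omega

lemma monotone_hitEvent (x : ℤ) : Monotone fun n => hitEvent ξ N n x :=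
  fun _ _ hmn _ ⟨v, h1, h2, h3⟩ => ⟨v, h1, h2.trans hmn, h3⟩

/-! ### Independence of the subtrees -/

/-- The σ-algebra generated by the jumps and the offspring numbers of the particles in `S`. -/
abbrev sigmaOf (ξ : Vertex → Ω → ℤ) (N : Vertex → Ω → ℕ) (S : Set Vertex) : MeasurableSpace Ω :=
  ⨆ v ∈ S, MeasurableSpace.comap (fun ω => (ξ v ω, N v ω)) inferInstance

lemma sigmaOf_mono {S T : Set Vertex} (h : S ⊆ T) : sigmaOf ξ N S ≤ sigmaOf ξ N T :=
  biSup_mono h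

lemma measurable_pair_sigmaOf {S : Set Vertex} {v : Vertex} (hv : v ∈ S) :
    Measurable[sigmaOf ξ N S] fun ω => (ξ v ω, N v ω) :=
  measurable_iff_comap_le.2
    (le_biSup (fun v => MeasurableSpace.comap (fun ω => (ξ v ω, N v ω)) inferInstance) hv)

lemma measurableSet_hitEvent_sigmaOf (n : ℕ) (x : ℤ) :
    MeasurableSet[sigmaOf ξ N Set.univ] (hitEvent ξ N n x) := by
  let _ := sigmaOf ξ N Set.univ
  have hξ : ∀ v, Measurable (ξ v) := fun v =>
    measurable_fst.comp (measurable_pair_sigmaOf (ξ := ξ) (N := N) (Set.mem_univ v))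
  have hN : ∀ v, Measurable (N v) := fun v =>
    measurable_snd.comp (measurable_pair_sigmaOf (ξ := ξ) (N := N) (Set.mem_univ v))
  have hpos : ∀ v, Measurable fun ω => position ξ ω v := fun v => by
    induction v with
    | nil => exact measurable_const
    | cons i v ih => exact ih.add (hξ v)
  have htree : ∀ v, MeasurableSet {ω | InTree N ω v} := fun v => by
    induction v with
    | nil => simp [InTree]
    | cons i v ih => exact ih.inter (hN v (measurableSet_Ioi (a := i)))
  have : hitEvent ξ N n x = ⋃ v : Vertex, ⋃ _ : v.length ≤ n,
      {ω | InTree N ω v} ∩ {ω | x ≤ position ξ ω v} := by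
    ext ω
    simp only [hitEvent, Set.mem_ofPred_eq, Set.mem_iUnion, Set.mem_inter_iff]
    exact ⟨fun ⟨v, h1, h2, h3⟩ => ⟨v, h2, h1, h3⟩, fun ⟨v, h2, h1, h3⟩ => ⟨v, h1, h2, h3⟩⟩
  rw [this]
  exact MeasurableSet.iUnion fun v => MeasurableSet.iUnion fun _ =>
    (htree v).inter (hpos v (measurableSet_Ici (a := x)))

lemma sigmaOf_shift_le (i : ℕ) :
    sigmaOf (shift i ξ) (shift i N) Set.univ ≤ sigmaOf ξ N {v | ∃ w, v = w ++ [i]} :=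
  iSup₂_le fun w _ => measurable_iff_comap_le.1
    (measurable_pair_sigmaOf (ξ := ξ) (N := N) (S := {v | ∃ w, v = w ++ [i]}) ⟨w, rfl⟩)

variable [mΩ : MeasurableSpace Ω] {μ : Measure Ω} {a : PMF ℤ} {p : PMF ℕ}

lemma IsBranchingRandomWalk.shift (h : IsBranchingRandomWalk μ a p ξ N) (i : ℕ) :
    IsBranchingRandomWalk μ a p (shift i ξ) (shift i N) where
  measurable_jump _ := h.measurable_jump _
  measurable_offspring _ := h.measurable_offspring _
  law _ := h.law _
  indep := h.indep.precomp (g := fun v : Vertex => v ++ [i]) (List.append_left_injective [i])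

lemma IsBranchingRandomWalk.sigmaOf_le (h : IsBranchingRandomWalk μ a p ξ N) (S : Set Vertex) :
    sigmaOf ξ N S ≤ mΩ :=
  iSup₂_le fun v _ =>
    measurable_iff_comap_le.1 ((h.measurable_jump v).prodMk (h.measurable_offspring v))

lemma IsBranchingRandomWalk.measurableSet_hitEvent (h : IsBranchingRandomWalk μ a p ξ N) (n : ℕ)
    (x : ℤ) : MeasurableSet (hitEvent ξ N n x) :=
  h.sigmaOf_le _ _ (measurableSet_hitEvent_sigmaOf n x)

lemma IsBranchingRandomWalk.indep_sigmaOf (h : IsBranchingRandomWalk μ a p ξ N)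
    {S T : Set Vertex} (hST : Disjoint S T) : Indep (sigmaOf ξ N S) (sigmaOf ξ N T) μ :=
  indep_iSup_of_disjoint (fun v =>
    measurable_iff_comap_le.1 ((h.measurable_jump v).prodMk (h.measurable_offspring v)))
    h.indep hST

lemma IsBranchingRandomWalk.measureReal_root (h : IsBranchingRandomWalk μ a p ξ N) (y : ℤ)
    (k : ℕ) : μ.real {ω | ξ [] ω = y ∧ N [] ω = k} = (a y).toReal * (p k).toReal := by
  have h1 : {ω | ξ [] ω = y ∧ N [] ω = k} = (fun ω => (ξ [] ω, N [] ω)) ⁻¹' ({y} ×ˢ {k}) := by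
    ext ω
    simp
  rw [measureReal_def, h1, ← Measure.map_apply
    ((h.measurable_jump _).prodMk (h.measurable_offspring _))
    ((measurableSet_singleton y).prod (measurableSet_singleton k)), h.law, Measure.prod_prod,
    PMF.toMeasure_apply_singleton _ _ (measurableSet_singleton y),
    PMF.toMeasure_apply_singleton _ _ (measurableSet_singleton k), ENNReal.toReal_mul]

/-- The initial particle and the subtrees of its children are independent. -/
lemma IsBranchingRandomWalk.measureReal_root_inter [IsProbabilityMeasure μ]
    (h : IsBranchingRandomWalk μ a p ξ N) {n : ℕ} {x : ℤ} {q : ℝ}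
    (hq : ∀ i, μ.real (hitEvent (BRW.shift i ξ) (BRW.shift i N) n x) = q) (y : ℤ) (k j : ℕ) :
    μ.real ({ω | ξ [] ω = y ∧ N [] ω = k} ∩
      ⋂ i < j, (hitEvent (BRW.shift i ξ) (BRW.shift i N) n x)ᶜ)
      = (a y).toReal * (p k).toReal * (1 - q) ^ j := by
  induction j with
  | zero => simp [h.measureReal_root]
  | succ j ih =>
    set S : Set Vertex := {v | v = [] ∨ ∃ i < j, ∃ w, v = w ++ [i]} with hS
    have hroot : MeasurableSet[sigmaOf ξ N S] {ω | ξ [] ω = y ∧ N [] ω = k} := by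
      have h1 := measurable_pair_sigmaOf (ξ := ξ) (N := N) (show [] ∈ S from Or.inl rfl)
        ((measurableSet_singleton y).prod (measurableSet_singleton k))
      convert h1 using 1
      ext ω
      simp
    have hsub : ∀ i, MeasurableSet[sigmaOf ξ N {v | ∃ w, v = w ++ [i]}]
        (hitEvent (BRW.shift i ξ) (BRW.shift i N) n x)ᶜ := fun i =>
      (sigmaOf_shift_le i _ (measurableSet_hitEvent_sigmaOf n x)).compl
    have h1 : MeasurableSet[sigmaOf ξ N S] ({ω | ξ [] ω = y ∧ N [] ω = k} ∩
        ⋂ i < j, (hitEvent (BRW.shift i ξ) (BRW.shift i N) n x)ᶜ) := by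
      refine @MeasurableSet.inter _ (sigmaOf ξ N S) _ _ hroot ?_
      refine @MeasurableSet.iInter _ _ (sigmaOf ξ N S) _ _ fun i => ?_
      refine @MeasurableSet.iInter _ _ (sigmaOf ξ N S) _ _ fun hi => ?_
      exact sigmaOf_mono (fun v hv => Or.inr ⟨i, hi, hv⟩) _ (hsub i)
    have hdisj : Disjoint S {v | ∃ w, v = w ++ [j]} := by
      refine Set.disjoint_left.2 ?_
      rintro v (rfl | ⟨i, hi, w, rfl⟩) ⟨w', hw'⟩
      · simp at hw'
      · have := (List.append_inj' hw' rfl).2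
        simp only [List.cons.injEq, and_true] at this
        omega
    have h2 := (Indep_iff _ _ μ).1 (h.indep_sigmaOf hdisj) _ _ h1 (hsub j)
    have h3 : ({ω | ξ [] ω = y ∧ N [] ω = k} ∩
        ⋂ i < j + 1, (hitEvent (BRW.shift i ξ) (BRW.shift i N) n x)ᶜ)
        = ({ω | ξ [] ω = y ∧ N [] ω = k} ∩
          ⋂ i < j, (hitEvent (BRW.shift i ξ) (BRW.shift i N) n x)ᶜ)
          ∩ (hitEvent (BRW.shift j ξ) (BRW.shift j N) n x)ᶜ := by
      rw [Set.biInter_lt_succ, Set.inter_assoc]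
    rw [h3, measureReal_def, h2, ENNReal.toReal_mul, ← measureReal_def, ih, ← measureReal_def,
      probReal_compl_eq_one_sub ((h.shift j).measurableSet_hitEvent n x), hq, pow_succ, mul_assoc]

/-- `P(M_n ≥ x)` satisfies the recursion that defines `hitProb`. -/
theorem IsBranchingRandomWalk.measureReal_hitEvent [IsProbabilityMeasure μ]
    (h : IsBranchingRandomWalk μ a p ξ N) (n : ℕ) (x : ℤ) :
    μ.real (hitEvent ξ N n x) = hitProb a p n x := by
  rcases le_or_gt x 0 with hx | hx
  · simp [hitEvent_of_nonpos hx, hitProb_of_nonpos hx]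
  induction n generalizing x ξ N with
  | zero => simp [hitEvent_zero_of_pos hx, hitProb_zero_of_pos hx]
  | succ n ih =>
    have hq : ∀ (z : ℤ) (i : ℕ),
        μ.real (hitEvent (BRW.shift i ξ) (BRW.shift i N) n z) = hitProb a p n z := fun z i => by
      rcases le_or_gt z 0 with hz | hz
      · simp [hitEvent_of_nonpos hz, hitProb_of_nonpos hz]
      · exact ih (h.shift i) z hz
    have hroot : ∀ (y : ℤ) (k : ℕ), MeasurableSet {ω | ξ [] ω = y ∧ N [] ω = k} := fun y k =>
      (h.measurable_jump [] (measurableSet_singleton y)).inter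
        (h.measurable_offspring [] (measurableSet_singleton k))
    set E : ℤ × ℕ → Set Ω := fun yk => {ω | ξ [] ω = yk.1 ∧ N [] ω = yk.2} \
      ⋂ i < yk.2, (hitEvent (BRW.shift i ξ) (BRW.shift i N) n (x - yk.1))ᶜ with hE
    have hI : ∀ (z : ℤ) (k : ℕ), MeasurableSet
        (⋂ i < k, (hitEvent (BRW.shift i ξ) (BRW.shift i N) n z)ᶜ) := fun z k =>
      MeasurableSet.iInter fun i => MeasurableSet.iInter fun _ =>
        ((h.shift i).measurableSet_hitEvent n z).compl
    have hunion : hitEvent ξ N (n + 1) x = ⋃ yk, E yk := by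
      ext ω
      rw [mem_hitEvent_succ_iff hx]
      simp [hE]
    have hdisj : Pairwise (Function.onFun Disjoint E) := fun yk yk' hne =>
      Set.disjoint_left.2 fun ω hω hω' => hne (Prod.ext (hω.1.1.symm.trans hω'.1.1)
        (hω.1.2.symm.trans hω'.1.2))
    have hEm : ∀ yk, MeasurableSet (E yk) := fun yk => (hroot _ _).diff (hI _ _)
    have hEval : ∀ yk, μ.real (E yk) = (a yk.1).toReal *
        ((p yk.2).toReal * (1 - (1 - hitProb a p n (x - yk.1)) ^ yk.2)) := fun yk => by
      have h1 := measureReal_sdiff_add_inter (μ := μ)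
        (s := {ω | ξ [] ω = yk.1 ∧ N [] ω = yk.2}) (hI (x - yk.1) yk.2)
      rw [h.measureReal_root_inter (hq _), h.measureReal_root] at h1
      simp only [hE]
      linarith
    have hsum : HasSum (fun yk => μ.real (E yk)) (μ.real (hitEvent ξ N (n + 1) x)) := by
      have h1 := measure_iUnion (μ := μ) hdisj hEm
      have h2 : Summable fun yk => μ.real (E yk) :=
        ENNReal.summable_toReal (by rw [← h1]; exact measure_ne_top _ _)
      have h3 : ∑' yk, μ.real (E yk) = μ.real (hitEvent ξ N (n + 1) x) := by
        rw [hunion, measureReal_def, h1, ENNReal.tsum_toReal_eq fun yk => measure_ne_top _ _]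
        rfl
      exact h3 ▸ h2.hasSum
    rw [hitProb_succ_of_pos hx, ← hsum.tsum_eq, hsum.summable.tsum_prod]
    refine tsum_congr fun y => ?_
    simp only [hEval, tsum_mul_left, markedProb]

lemma IsBranchingRandomWalk.probUpTo_eq [IsProbabilityMeasure μ]
    (h : IsBranchingRandomWalk μ a p ξ N) (n : ℕ) (x : ℝ) :
    probUpTo μ ξ N n x = hitProb a p n ⌈x⌉ := by
  rw [probUpTo, setOf_le_maxUpTo, h.measureReal_hitEvent]

lemma IsBranchingRandomWalk.probEver_eq [IsProbabilityMeasure μ]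
    (h : IsBranchingRandomWalk μ a p ξ N) (x : ℝ) :
    probEver μ ξ N x = hitProbEver a p ⌈x⌉ := by
  rw [probEver, setOf_le_maxEver]
  refine tendsto_nhds_unique ?_ (tendsto_hitProb ⌈x⌉)
  have h1 := tendsto_measure_iUnion_atTop (μ := μ) (monotone_hitEvent (ξ := ξ) (N := N) ⌈x⌉)
  have h2 := (ENNReal.tendsto_toReal (measure_ne_top μ _)).comp h1
  refine h2.congr fun n => ?_
  exact h.measureReal_hitEvent n _

end BRW

namespace BRW

/-! ### Asymptotics along rays -/

lemma mul_rpow_lt_one_iff {β q c : ℝ} (hβ : 0 < β) (hq : 1 < q) :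
    β * q ^ c < 1 ↔ c < -Real.log β / Real.log q := by
  have hq0 : 0 < q := by linarith
  rw [lt_div_iff₀ (Real.log_pos hq), ← Real.log_neg_iff (by positivity),
    Real.log_mul hβ.ne' (by positivity), Real.log_rpow hq0]
  constructor <;> intro h <;> linarith

lemma tendsto_pow_mul_zpow_ceil {β q c : ℝ} (hβ : 0 < β) (hq : 1 < q) (hc : β * q ^ c < 1) :
    Tendsto (fun n : ℕ => β ^ n * q ^ ⌈c * n⌉) atTop (𝓝 0) := by
  have hq0 : 0 < q := by linarith
  have h1 := (tendsto_pow_atTop_nhds_zero_of_lt_one (by positivity) hc).const_mul q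
  rw [mul_zero] at h1
  refine tendsto_of_tendsto_of_tendsto_of_le_of_le tendsto_const_nhds h1
    (fun n => by positivity) fun n => ?_
  have h2 : q ^ ⌈c * n⌉ ≤ q ^ (c * n + 1) := by
    rw [← Real.rpow_intCast]
    exact Real.rpow_le_rpow_of_exponent_le hq.le (Int.ceil_lt_add_one _).le
  calc β ^ n * q ^ ⌈c * n⌉ ≤ β ^ n * q ^ (c * n + 1) := by gcongr
    _ = q * (β * q ^ c) ^ n := by
      rw [Real.rpow_add hq0, Real.rpow_one, Real.rpow_mul hq0.le, Real.rpow_natCast, mul_pow]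
      ring

lemma tendsto_ceil_mul {c : ℝ} (hc : 0 < c) :
    Tendsto (fun n : ℕ => ⌈c * n⌉) atTop atTop :=
  tendsto_ceil_atTop.comp (tendsto_natCast_atTop_atTop.const_mul_atTop hc)

variable {a : PMF ℤ} {p : PMF ℕ}

/-- Along `x = c n` with `c` small, `hitProb` is at least of the order `ρ ^ (-x)`. -/
lemma exists_eventually_le_hitProb (ha : JumpAssumption a) (hp : OffspringAssumption p) {ρ r : ℝ}
    (hρ1 : 1 < ρ) (hρ : offspringMean p * genFun a ρ = 1) (hr : 1 < r) (hrρ : r < ρ) :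
    ∃ α : ℝ, 0 < α ∧ ∀ c : ℝ, 0 < c → offspringMean p * genFun a r * (ρ / r) ^ c < 1 →
      ∀ᶠ n : ℕ in atTop, α ≤ ρ ^ ⌈c * n⌉ * hitProb a p n ⌈c * n⌉ := by
  obtain ⟨α, G, hα, hlow⟩ := exists_le_hitProb ha hp hρ1 hρ hr hrρ (s := (ρ + ρ ^ 2) / 2)
    (by nlinarith) (by nlinarith)
  set s := (ρ + ρ ^ 2) / 2 with hs
  have hρ0 : 0 < ρ := by linarith
  have hr0 : 0 < r := by linarith
  have hs1 : ρ < s := by rw [hs]; nlinarith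
  have hs0 : 0 < s := by linarith
  have hK : 0 < offspringMean p * genFun a r := by
    have h1 := ha.genFun_strictMono le_rfl hr
    rw [genFun_one] at h1
    exact mul_pos hp.mean_pos (by linarith)
  refine ⟨α / 2, by positivity, fun c hc hc1 => ?_⟩
  have h1 := (tendsto_pow_mul_zpow_ceil hK ((one_lt_div hr0).2 hrρ) hc1).const_mul G
  have h2 : Tendsto (fun n : ℕ => (ρ / s ^ 2) ^ ⌈c * n⌉) atTop (𝓝 0) := by
    have h3 : ρ / s ^ 2 < 1 := (div_lt_one (by positivity)).2 (by nlinarith)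
    have h4 := (tendsto_pow_atTop_nhds_zero_of_lt_one (by positivity) h3).comp
      (tendsto_nat_ceil_atTop.comp (tendsto_natCast_atTop_atTop.const_mul_atTop hc))
    refine h4.congr fun n => ?_
    rw [← Int.natCast_ceil_eq_ceil (by positivity : 0 ≤ c * n), zpow_natCast]
    rfl
  have h5 := ((h2.const_sub 1).sub h1).const_mul α
  rw [mul_zero, sub_zero, sub_zero, mul_one] at h5
  filter_upwards [h5.eventually (lt_mem_nhds (half_lt_self hα))] with n hn
  refine hn.le.trans ?_
  have h6 := mul_le_mul_of_nonneg_left (hlow n ⌈c * n⌉)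
    (by positivity : 0 ≤ ρ ^ ⌈c * n⌉)
  refine le_trans (le_of_eq ?_) h6
  generalize ⌈c * (n : ℝ)⌉ = x
  rw [div_zpow, div_zpow, zpow_neg, zpow_neg, zpow_neg]
  field_simp

/-- Along `x = c n` with `c` small, levels are reached either within `n` generations or, up to an
event of negligible probability, never. -/
lemma tendsto_hitProbEver_sub_hitProb (ha : JumpAssumption a) (hp : OffspringAssumption p)
    {ρ r c : ℝ} (hρ : offspringMean p * genFun a ρ = 1) (hr : 1 < r) (hrρ : r < ρ)
    (hc : offspringMean p * genFun a r * (ρ / r) ^ c < 1) :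
    Tendsto (fun n : ℕ => ρ ^ ⌈c * n⌉ * (hitProbEver a p ⌈c * n⌉ - hitProb a p n ⌈c * n⌉))
      atTop (𝓝 0) := by
  have hr0 : 0 < r := by linarith
  have hρ0 : 0 < ρ := by linarith
  have hK : 0 < offspringMean p * genFun a r := by
    have h1 := ha.genFun_strictMono le_rfl hr
    rw [genFun_one] at h1
    exact mul_pos hp.mean_pos (by linarith)
  refine tendsto_of_tendsto_of_tendsto_of_le_of_le tendsto_const_nhds
    (tendsto_pow_mul_zpow_ceil hK ((one_lt_div hr0).2 hrρ) hc) (fun n => ?_) fun n => ?_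
  · exact mul_nonneg (by positivity) (sub_nonneg.2 (hitProb_le_hitProbEver _ _))
  · refine (mul_le_mul_of_nonneg_left (hitProbEver_sub_le ha hp hρ hr.le hrρ.le n ⌈c * n⌉)
      (by positivity)).trans (le_of_eq ?_)
    rw [div_zpow, zpow_neg]
    field_simp

/-- The probability of ever reaching `x` is asymptotically a multiple of `ρ ^ (-x)`: after
multiplication by `ρ ^ x` it becomes almost harmonic for the tilted walk with step law
`m a_y ρ ^ y`. -/
lemma exists_tendsto_zpow_mul_hitProbEver (ha : JumpAssumption a) (hp : OffspringAssumption p)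
    {ρ : ℝ} (hρ1 : 1 < ρ) (hρ : offspringMean p * genFun a ρ = 1) {R : ℕ}
    (hR : HasRightRange a R) (ha1 : a 1 ≠ 0) :
    ∃ κ, Tendsto (fun x : ℤ => ρ ^ x * hitProbEver a p x) atTop (𝓝 κ) := by
  have hm := hp.mean_pos
  have hρ0 : 0 < ρ := by linarith
  obtain ⟨D, hD, hDsum⟩ := ha.exists_hasSum_tilted_drift hR hρ1
  set s := (ρ + ρ ^ 2) / 2 with hs
  have hsρ : ρ < s := by rw [hs]; nlinarith
  have hsρ2 : s ≤ ρ ^ 2 := by rw [hs]; nlinarith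
  have hs0 : 0 < s := by linarith
  obtain ⟨B, hB, hlow⟩ := exists_hitProbEver_ge ha hp hρ1 hρ (hρ1.trans hsρ) hsρ2
  have hT : ∀ x : ℤ, ∑' y : ℤ, offspringMean p * ((a y).toReal * ρ ^ y) *
      (ρ ^ (x - y) * hitProbEver a p (x - y)) =
      ρ ^ x * (offspringMean p * ∑' y, (a y).toReal * hitProbEver a p (x - y)) := fun x => by
    rw [← tsum_mul_left, ← tsum_mul_left]
    refine tsum_congr fun y => ?_
    have : ρ ^ x = ρ ^ y * ρ ^ (x - y) := by rw [← zpow_add₀ hρ0.ne']; congr 1; ring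
    rw [this]
    ring
  refine exists_tendsto_of_almost_harmonic (b := fun y => offspringMean p * ((a y).toReal * ρ ^ y))
    (R := R) (D := offspringMean p * D) (B := B) (r := s / ρ) (k := offspringMean p * genFun a s)
    (fun y => by positivity) ?_ (fun y hy => ?_) (by positivity) ?_ ?_ ((one_lt_div hρ0).2 hsρ)
    ?_ ?_ hB (fun x => ?_) (fun x => ?_) (fun x hx => ?_) fun x hx => ?_
  · simpa [hρ] using (ha.hasSum_genFun hρ1.le).mul_left (offspringMean p)
  · simp [hR.2.2 y hy]
  · refine (hDsum.mul_left (offspringMean p)).congr_fun fun y => ?_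
    ring
  · have := toReal_pos_of_ne_zero ha1
    positivity
  · refine ((ha.hasSum_genFun (hρ1.trans hsρ).le).mul_left (offspringMean p)).congr_fun
      fun y => ?_
    rw [div_zpow]
    field_simp
  · rw [← hρ]
    exact mul_lt_mul_of_pos_left (ha.genFun_strictMono hρ1.le hsρ) hm
  · exact mul_nonneg (by positivity) (hitProbEver_mem x).1
  · calc ρ ^ x * hitProbEver a p x ≤ ρ ^ x * ρ ^ (-x) :=
          mul_le_mul_of_nonneg_left (hitProbEver_le_zpow ha hp hρ1 hρ x) (by positivity)
      _ = 1 := by rw [zpow_neg, mul_inv_cancel₀ (by positivity)]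
  · rw [hT]
    exact mul_le_mul_of_nonneg_left (hitProbEver_le hp hx) (by positivity)
  · rw [hT]
    have h1 := mul_le_mul_of_nonneg_left (hlow x hx) (by positivity : 0 ≤ ρ ^ x)
    have h2 : (s / ρ) ^ (-x) = ρ ^ x * s ^ (-x) := by
      rw [div_zpow, zpow_neg ρ]
      field_simp
    rw [h2]
    linarith

end BRW

theorem theorem2 {Ω : Type*} [MeasurableSpace Ω] (μ : Measure Ω) [IsProbabilityMeasure μ]
    (a : PMF ℤ) (p : PMF ℕ) (ξ : BRW.Vertex → Ω → ℤ) (N : BRW.Vertex → Ω → ℕ)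
    (ha : BRW.JumpAssumption a) (hp : BRW.OffspringAssumption p)
    (hX : BRW.IsBranchingRandomWalk μ a p ξ N) :
    -- `ρ(1 / m)` is well defined
    (∃! s : ℝ, 1 < s ∧ BRW.genFun a s = (BRW.offspringMean p)⁻¹) ∧
    ∃ δlow δup : ℝ, 0 < δlow ∧ δlow ≤ δup ∧
      -- (a)
      (∀ c : ℝ, 0 < c → c < δlow →
        0 < liminf (fun n : ℕ => (BRW.g μ a p ξ N c n : EReal)) atTop ∧
        liminf (fun n : ℕ => (BRW.g μ a p ξ N c n : EReal)) atTop ≤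
          limsup (fun n : ℕ => (BRW.g μ a p ξ N c n : EReal)) atTop ∧
        limsup (fun n : ℕ => (BRW.g μ a p ξ N c n : EReal)) atTop ≤ 1) ∧
      -- (b)
      (∀ R : ℕ, BRW.HasRightRange a R → BRW.NearlyRightContinuous a R →
        ∃ κ : ℝ, 0 < κ ∧ κ ≤ 1 ∧
          Tendsto (BRW.ell μ a p ξ N) atTop (𝓝 κ) ∧
          ∀ c : ℝ, 0 < c → c < δlow →
            Tendsto (BRW.gCeil μ a p ξ N c) atTop (𝓝 κ) ∧
            Tendsto (BRW.g μ a p ξ N c)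
              (atTop ⊓ 𝓟 {n : ℕ | ∃ k : ℤ, c * (n : ℝ) = (k : ℝ)}) (𝓝 κ)) ∧
      -- (c)
      (∀ c : ℝ, δup < c → Tendsto (BRW.g μ a p ξ N c) atTop (𝓝 0)) ∧
      (∀ R : ℕ, BRW.HasRightRange a R → δup < (R : ℝ)) := by
  have hm := hp.mean_pos
  have hγ : 1 < (BRW.offspringMean p)⁻¹ := (one_lt_inv₀ hm).2 hp.mean_lt_one
  refine ⟨ha.existsUnique_genFun_eq hγ, ?_⟩
  obtain ⟨hρ1, hKρ⟩ := ha.rho_spec hγ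
  have hg : ∀ c n, BRW.g μ a p ξ N c n =
      BRW.rho a (BRW.offspringMean p)⁻¹ ^ (c * n) * BRW.hitProb a p n ⌈c * n⌉ := fun c n => by
    rw [BRW.g, hX.probUpTo_eq]
  have hgC : ∀ c n, BRW.gCeil μ a p ξ N c n =
      BRW.rho a (BRW.offspringMean p)⁻¹ ^ ⌈c * n⌉ * BRW.hitProb a p n ⌈c * n⌉ := fun c n => by
    rw [BRW.gCeil, hX.probUpTo_eq, Int.ceil_intCast]
  have hell : ∀ n, BRW.ell μ a p ξ N n =
      BRW.rho a (BRW.offspringMean p)⁻¹ ^ (n : ℤ) * BRW.hitProbEver a p n := fun n => by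
    rw [BRW.ell, hX.probEver_eq, Int.ceil_natCast, zpow_natCast]
  generalize BRW.rho a (BRW.offspringMean p)⁻¹ = ρ at *
  have hρ : BRW.offspringMean p * BRW.genFun a ρ = 1 := by rw [hKρ, mul_inv_cancel₀ hm.ne']
  have hρ0 : 0 < ρ := by linarith
  -- Auxiliary points on either side of `ρ`, where `m K` is smaller and larger than `1`.
  obtain ⟨r, hr1, hrρ⟩ := exists_between hρ1
  obtain ⟨s, hρs⟩ := exists_gt ρ
  have hr0 : 0 < r := by linarith
  have hs0 : 0 < s := by linarith
  have hKr1 : BRW.offspringMean p * BRW.genFun a r < 1 := by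
    rw [← hρ]
    exact mul_lt_mul_of_pos_left (ha.genFun_strictMono hr1.le hrρ) hm
  have hKr0 : 0 < BRW.offspringMean p * BRW.genFun a r := by
    have h1 := ha.genFun_strictMono le_rfl hr1
    rw [BRW.genFun_one] at h1
    exact mul_pos hm (by linarith)
  have hKs : 1 < BRW.offspringMean p * BRW.genFun a s := by
    rw [← hρ]
    exact mul_lt_mul_of_pos_left (ha.genFun_strictMono hρ1.le hρs) hm
  have hq : 1 < ρ / r := (one_lt_div hr0).2 hrρ
  have hq' : 1 < s / ρ := (one_lt_div hρ0).2 hρs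
  set δup := Real.log (BRW.offspringMean p * BRW.genFun a s) / Real.log (s / ρ) with hδup
  have hδup0 : 0 < δup := div_pos (Real.log_pos hKs) (Real.log_pos hq')
  set δ := -Real.log (BRW.offspringMean p * BRW.genFun a r) / Real.log (ρ / r) with hδ
  have hδ0 : 0 < δ :=
    div_pos (neg_pos.2 (Real.log_neg hKr0 hKr1)) (Real.log_pos hq)
  have hδc : ∀ c < min δ δup, BRW.offspringMean p * BRW.genFun a r * (ρ / r) ^ c < 1 :=
    fun c hc => (BRW.mul_rpow_lt_one_iff hKr0 hq).2 (hc.trans_le (min_le_left _ _))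
  obtain ⟨α, hα, hlow⟩ := BRW.exists_eventually_le_hitProb ha hp hρ1 hρ hr1 hrρ
  refine ⟨min δ δup, δup, lt_min hδ0 hδup0, min_le_right _ _, fun c hc0 hc => ⟨?_, ?_, ?_⟩,
    fun R hR hcont => ?_, fun c hc => ?_, fun R hR => ?_⟩
  · have h1 : ∀ᶠ n : ℕ in atTop, ((ρ⁻¹ * α : ℝ) : EReal) ≤ BRW.g μ a p ξ N c n := by
      filter_upwards [hlow c hc0 (hδc c hc)] with n hn
      refine EReal.coe_le_coe_iff.2 ?_
      rw [hg]
      have h2 : ρ⁻¹ * ρ ^ ⌈c * n⌉ ≤ ρ ^ (c * n) := by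
        rw [← Real.rpow_intCast, ← Real.rpow_neg_one, ← Real.rpow_add hρ0]
        exact Real.rpow_le_rpow_of_exponent_le hρ1.le (by linarith [Int.ceil_lt_add_one (c * n)])
      calc ρ⁻¹ * α ≤ ρ⁻¹ * (ρ ^ ⌈c * n⌉ * BRW.hitProb a p n ⌈c * n⌉) := by gcongr
        _ = ρ⁻¹ * ρ ^ ⌈c * n⌉ * BRW.hitProb a p n ⌈c * n⌉ := by ring
        _ ≤ _ := mul_le_mul_of_nonneg_right h2 (BRW.hitProb_mem _ _).1
    refine lt_of_lt_of_le ?_ (le_liminf_of_le (by isBoundedDefault) h1)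
    exact_mod_cast (by positivity : 0 < ρ⁻¹ * α)
  · exact liminf_le_limsup
  · refine limsup_le_of_le (by isBoundedDefault) (Eventually.of_forall fun n => ?_)
    have h1 : BRW.g μ a p ξ N c n ≤ 1 := by
      rw [hg]
      have h2 := BRW.hitProb_le_pow_mul_zpow ha hp hρ1.le hρ.ge n ⌈c * n⌉
      rw [hρ, one_pow, one_mul] at h2
      refine (mul_le_mul_of_nonneg_left h2 (by positivity)).trans ?_
      rw [← Real.rpow_intCast, ← Real.rpow_add hρ0]
      refine Real.rpow_le_one_of_one_le_of_nonpos hρ1.le ?_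
      push_cast
      linarith [Int.le_ceil (c * n)]
    exact_mod_cast h1
  · obtain ⟨κ, hκ⟩ := BRW.exists_tendsto_zpow_mul_hitProbEver ha hp hρ1 hρ hR
      (by simpa using hcont 1 le_rfl hR.1)
    have hC : ∀ c : ℝ, 0 < c → c < min δ δup → Tendsto (BRW.gCeil μ a p ξ N c) atTop (𝓝 κ) :=
      fun c hc0 hc => by
        have h1 := (hκ.comp (BRW.tendsto_ceil_mul hc0)).sub
          (BRW.tendsto_hitProbEver_sub_hitProb ha hp hρ hr1 hrρ (hδc c hc))
        rw [sub_zero] at h1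
        refine h1.congr fun n => ?_
        rw [hgC]
        simp only [Function.comp_apply]
        ring
    refine ⟨κ, ?_, ?_, ?_, fun c hc0 hc => ⟨hC c hc0 hc, ?_⟩⟩
    · obtain ⟨c, hc0, hc⟩ := exists_between (lt_min hδ0 hδup0)
      refine hα.trans_le (ge_of_tendsto (hC c hc0 hc) ?_)
      filter_upwards [hlow c hc0 (hδc c hc)] with n hn
      rwa [hgC]
    · refine le_of_tendsto' hκ fun x => ?_
      calc ρ ^ x * BRW.hitProbEver a p x ≤ ρ ^ x * ρ ^ (-x) :=
            mul_le_mul_of_nonneg_left (BRW.hitProbEver_le_zpow ha hp hρ1 hρ x) (by positivity)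
        _ = 1 := by rw [zpow_neg, mul_inv_cancel₀ (by positivity)]
    · exact (hκ.comp tendsto_natCast_atTop_atTop).congr fun n => (hell n).symm
    · refine ((hC c hc0 hc).mono_left inf_le_left).congr' ?_
      filter_upwards [mem_inf_of_right (mem_principal_self _)] with n hn
      obtain ⟨k, hk⟩ := hn
      rw [hg, hgC, hk, Int.ceil_intCast, Real.rpow_intCast]
  · have h0 : 0 < BRW.offspringMean p * BRW.genFun a s := by linarith
    have hβ : BRW.offspringMean p * BRW.genFun a s * (s / ρ) ^ (-c) < 1 := by
      rw [BRW.mul_rpow_lt_one_iff h0 hq', neg_div]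
      exact neg_lt_neg hc
    refine tendsto_of_tendsto_of_tendsto_of_le_of_le tendsto_const_nhds
      (tendsto_pow_atTop_nhds_zero_of_lt_one (by positivity) hβ) (fun n => ?_) fun n => ?_
    · simp only [hg]
      exact mul_nonneg (by positivity) (BRW.hitProb_mem _ _).1
    · simp only [hg]
      have h1 := BRW.hitProb_le_pow_mul_zpow ha hp (hρ1.trans hρs).le hKs.le n ⌈c * n⌉
      have h2 : s ^ (-⌈c * n⌉) ≤ s ^ (-(c * n)) := by
        rw [← Real.rpow_intCast]
        refine Real.rpow_le_rpow_of_exponent_le (hρ1.trans hρs).le ?_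
        push_cast
        linarith [Int.le_ceil (c * n)]
      calc ρ ^ (c * n) * BRW.hitProb a p n ⌈c * n⌉
          ≤ ρ ^ (c * n) * ((BRW.offspringMean p * BRW.genFun a s) ^ n * s ^ (-(c * n))) := by
            refine mul_le_mul_of_nonneg_left (h1.trans ?_) (by positivity)
            gcongr
        _ = _ := by
            rw [mul_pow (BRW.offspringMean p * BRW.genFun a s),
              ← Real.rpow_natCast ((s / ρ) ^ (-c)), ← Real.rpow_mul (by positivity),
              neg_mul, Real.div_rpow hs0.le hρ0.le, Real.rpow_neg hs0.le, Real.rpow_neg hρ0.le]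
            field_simp
  · rw [hδup, div_lt_iff₀ (Real.log_pos hq'), ← Real.log_pow]
    refine Real.log_lt_log (by linarith) ?_
    have h1 := mul_lt_mul_of_pos_left (ha.genFun_lt_of_hasRightRange hR hρ1.le hρs) hm
    rwa [← mul_assoc, hρ, one_mul] at h1
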